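/- Let $1\le d'<n'$ and let $M'\subset\mathbb C^{n'}$ be a generic real analytic local submanifold of codimension $d'$ through the origin, given by $\rho'_1(t',\bar t')=\dots=\rho'_{d'}(t',\bar t')=0$, where the power series $\rho'_j\in\mathbb C\{t',\bar t'\}$ converge, satisfy $\rho'_j(t',\bar t')=\overline{\rho'_j}(\bar t',t')$, vanish at the origin, and have complex differentials $\partial\rho'_1,\dots,\partial\rho'_{d'}$ that are linearly independent at the origin. A formal CR self-map of $M'$ is an $n'$-tuple $h(t')$ of formal power series without constant term such that $\rho'(h(t'),\bar h(\bar t'))=b(t',\bar t')\,\rho'(t',\bar t')$ for some $d'\times d'$ matrix $b$ of formal power series; it is a formal CR equivalence if moreover its Jacobian matrix at the origin is invertible, and it is convergent if all its components are convergent power series. (1) Let $X'=\sum_{i}a'_i(t')\,\partial/\partial t'_i$ be a nonzero vector field with holomorphic coefficients near the origin that is tangent to $M'$, i.e. $X'\rho'_j=0$ at all points of $M'$ near the origin for every $j$. Then $X'$ has a local holomorphic flow $\varphi'(s',t')=\exp(s'X')(t')$ near $(0,0)\in\mathbb C\times\mathbb C^{n'}$, characterized by $\varphi'(0,t')=t'$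 and $\partial_{s'}\varphi'_i=a'_i(\varphi')$. For every index $i$ and every nonconvergent formal power series $\varpi'(t')\in\mathbb C[[t']]$ without constant term such that $\partial_{s'}\varphi'_i(\varpi'(t'),t')\not\equiv0$, the formal map $t'\mapsto\varphi'(\varpi'(t'),t')=\exp(\varpi'(t')X')(t')$ is a formal CR self-map of $M'$ that is not convergent. (2) Consequently holomorphic nondegeneracy is necessary for convergence: if every formal CR equivalence of $(M',0)$ onto itself is convergent, then $M'$ is holomorphically nondegenerate, i.e. no nonzero vector field with holomorphic coefficients near the origin is tangent to $M'$. -/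

import Mathlib

open Filter Topology

namespace FormalCR

noncomputable section

/-- Convergent power series: the coefficients satisfy a Cauchy estimate
`|f_α| ≤ C r^{-|α|}` for some `C, r > 0`. -/
def IsConvergent {σ : Type*} (f : MvPowerSeries σ ℂ) : Prop :=
  ∃ C : ℝ, 0 < C ∧ ∃ r : ℝ, 0 < r ∧
    ∀ α : σ →₀ ℕ, ‖MvPowerSeries.coeff α f‖ ≤ C * r⁻¹ ^ α.degree

/-- The value of a (convergent) power series at a point, meaningful close to the origin. -/
def evalAt {σ : Type*} (f : MvPowerSeries σ ℂ) (x : σ → ℂ) : ℂ :=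
  ∑' α : σ →₀ ℕ, MvPowerSeries.coeff α f * α.prod (fun i k => x i ^ k)

/-- `f ↦ f̄`: conjugation of the coefficients of a power series. -/
def conjSeries {σ : Type*} (f : MvPowerSeries σ ℂ) : MvPowerSeries σ ℂ :=
  MvPowerSeries.map (starRingEnd ℂ) f

/-- Power series in `(t, t̄)`, with `t = (t_1, …, t_n)`: the variable `Sum.inl i` is `t_i` and the
variable `Sum.inr i` is `t̄_i`, treated as an independent variable. -/
abbrev CRSeries (n : ℕ) : Type := MvPowerSeries (Fin n ⊕ Fin n) ℂ

/-- `ρ_1, …, ρ_d` are real analytic local defining equations of a generic real analytic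
submanifold of `ℂⁿ` of codimension `d` through the origin: the `ρ_j(t, t̄)` converge, satisfy the
reality condition `ρ_j(t, t̄) = ρ̄_j(t̄, t)`, vanish at the origin, and the complex differentials
`∂ρ_1, …, ∂ρ_d` at the origin are linearly independent. -/
structure IsGenericDefining {n d : ℕ} (ρ : Fin d → CRSeries n) : Prop where
  convergent : ∀ j, IsConvergent (ρ j)
  real : ∀ j, ρ j = MvPowerSeries.rename Sum.swap (conjSeries (ρ j))
  zero : ∀ j, MvPowerSeries.constantCoeff (ρ j) = 0
  generic : LinearIndependent ℂ (fun j : Fin d => fun i : Fin n =>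
    MvPowerSeries.constantCoeff (MvPowerSeries.pderiv ℂ (Sum.inl i) (ρ j)))

/-- The point `(p, p̄)`. -/
def withConj {n : ℕ} (p : Fin n → ℂ) : Fin n ⊕ Fin n → ℂ :=
  Sum.elim p (fun i => starRingEnd ℂ (p i))

/-- The holomorphic vector field `X = ∑ a_i(t) ∂/∂t_i` is tangent, near the origin, to the real
submanifold `M = {p : ρ(p, p̄) = 0}`: at all points `p` of `M` close to `0`,
`X ρ_j = ∑ a_i(p) ∂ρ_j/∂t_i (p, p̄)` vanishes for every `j`. -/
def IsTangent {n d : ℕ} (a : Fin n → MvPowerSeries (Fin n) ℂ) (ρ : Fin d → CRSeries n) : Prop :=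
  ∀ᶠ p : Fin n → ℂ in 𝓝 0,
    (∀ j, evalAt (ρ j) (withConj p) = 0) →
      ∀ j, ∑ i, evalAt (a i) p *
        evalAt (MvPowerSeries.pderiv ℂ (Sum.inl i) (ρ j)) (withConj p) = 0

/-- `M = {ρ = 0}` is holomorphically nondegenerate (at the origin): no nonzero vector field
with holomorphic coefficients near the origin is tangent to `M`. -/
def IsHolNondegenerate {n d : ℕ} (ρ : Fin d → CRSeries n) : Prop :=
  ¬ ∃ a : Fin n → MvPowerSeries (Fin n) ℂ, (∀ i, IsConvergent (a i)) ∧ a ≠ 0 ∧ IsTangent a ρ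

/-- `φ(s, t) = exp(sX)(t)` is the local holomorphic flow, near `(0, 0)`, of
`X = ∑ a_i(t) ∂/∂t_i`: it converges, `φ(0, t) = t` and `∂_s φ_i(s, t) = a_i(φ(s, t))`. The complex
time `s` is the variable `none` and `t_i` is the variable `some i`. -/
structure IsLocalFlow {n : ℕ} (a : Fin n → MvPowerSeries (Fin n) ℂ)
    (φ : Fin n → MvPowerSeries (Option (Fin n)) ℂ) : Prop where
  convergent : ∀ i, IsConvergent (φ i)
  initial : ∀ i, MvPowerSeries.subst
    (fun o : Option (Fin n) => o.elim (0 : MvPowerSeries (Fin n) ℂ) MvPowerSeries.X) (φ i) =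
      MvPowerSeries.X i
  ode : ∀ i, MvPowerSeries.pderiv ℂ none (φ i) = MvPowerSeries.subst φ (a i)

/-- `g(ϖ(t), t)`, for a series `g(s, t)` and a formal series `ϖ(t)` without constant term. -/
def substTime {n : ℕ} (ϖ : MvPowerSeries (Fin n) ℂ) (g : MvPowerSeries (Option (Fin n)) ℂ) :
    MvPowerSeries (Fin n) ℂ :=
  MvPowerSeries.subst (fun o : Option (Fin n) => o.elim ϖ MvPowerSeries.X) g

/-- The substitution `(t, t̄) ↦ (h(t), h̄(t̄))` in a series `f(t', t̄')`. -/
def substCR {n n' : ℕ} (h : Fin n' → MvPowerSeries (Fin n) ℂ) (f : CRSeries n') : CRSeries n :=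
  MvPowerSeries.subst
    (Sum.elim (fun i => MvPowerSeries.rename Sum.inl (h i))
      (fun i => MvPowerSeries.rename Sum.inr (conjSeries (h i))) :
        Fin n' ⊕ Fin n' → CRSeries n) f

/-- `h` is a formal CR map `(M, 0) → (M', 0)`, where `M = {ρ = 0}` and `M' = {ρ' = 0}`: it has no
constant term and `ρ'(h(t), h̄(t̄)) = b(t, t̄) ρ(t, t̄)` for a matrix `b` of formal series. -/
def IsFormalCRMap {n d n' d' : ℕ} (ρ : Fin d → CRSeries n) (ρ' : Fin d' → CRSeries n')
    (h : Fin n' → MvPowerSeries (Fin n) ℂ) : Prop :=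
  (∀ i, MvPowerSeries.constantCoeff (h i) = 0) ∧
    ∃ b : Matrix (Fin d') (Fin d) (CRSeries n), ∀ j, substCR h (ρ' j) = ∑ k, b j k * ρ k

/-- A formal CR equivalence: a formal CR map whose Jacobian at the origin is invertible. -/
def IsFormalCREquiv {n d d' : ℕ} (ρ : Fin d → CRSeries n) (ρ' : Fin d' → CRSeries n)
    (h : Fin n → MvPowerSeries (Fin n) ℂ) : Prop :=
  IsFormalCRMap ρ ρ' h ∧
    (Matrix.of fun i k => MvPowerSeries.constantCoeff (MvPowerSeries.pderiv ℂ k (h i))).det ≠ 0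

/-- A formal map converges if all its components do. -/
def IsConvergentMap {n n' : ℕ} (h : Fin n' → MvPowerSeries (Fin n) ℂ) : Prop :=
  ∀ i, IsConvergent (h i)

end

end FormalCR

open FormalCR

/-! CR part. The variables `t̄` are independent of `t`, so the time of the flow may be complex and
may even be a formal series in `t`. A tangent field satisfies `X ρ = c ρ` as power series
(`exists_eq_sum_mul_of_isTangent`): genericity gives a real retraction onto `M`, so that `X ρ`
composed with it vanishes at all `(p, p̄)`, hence identically; the composition kills only the ideal
generated by the `ρ_k`. Therefore `F(s, t, t̄) = ρ(φ(s, t), t̄)` solves the linear system `∂_s F =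
c(φ, t̄) F` with initial value `ρ(t, t̄)`, and `F = B ρ` (`exists_subst_flow_eq`). Putting `s =
ϖ(t)` gives `ρ(h(t), t̄) = b ρ(t, t̄)`; conjugation gives the analogous identity for `ρ(t, h̄(t̄))`;
composing the two gives the CR identity (`isFormalCRMap_substTime`).

Divergence part. If `φ_i(ϖ(t), t)` converges, then `ϖ` is a formal root of a convergent equation
`P(s, t) = 0` along which `∂_s P` does not vanish identically, and such a root converges
(`isConvergent_of_isConvergent_substTime`). After the blow-up `t = λ(c + u)`, with `c` off the zeros
of the leading form of `∂_s P(ϖ, t)`, this derivative becomes `λ^m` times a unit. Writing the root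
as `p + λ^(m+1) y` with `p` convergent, Taylor expansion and division by `λ^(2m+1)` turn the
equation into one for `y` covered by the implicit function theorem. Convergence descends through the
blow-up because every coefficient of a series reappears in its pullback.

For the second claim, take a tangent field `a ≠ 0` and `ϖ = ∑_{m ≥ N} m! t_1^m`. For large `N`, `∂_s
φ_i(ϖ, t)` agrees with `a_i` to an order at which `a_i ≠ 0` is visible, and the map is tangent to
the identity; so it is a divergent equivalence.

Analytic existence statements rest on weighted `ℓ¹` norms and one fixed point lemma,
`exists_fixedPoint`. -/

namespace FormalCR

noncomputable section

open MvPowerSeries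
open scoped ENNReal NNReal

/-! ### Weighted `ℓ¹` norms of power series -/

/-- The weighted `ℓ¹` norm `∑ |f_α| r^α`. -/
def wnorm {σ : Type*} (r : σ → ℝ≥0∞) (f : MvPowerSeries σ ℂ) : ℝ≥0∞ :=
  ∑' α : σ →₀ ℕ, ‖coeff α f‖ₑ * α.prod (fun i k => r i ^ k)

section wnorm

variable {σ τ : Type*} {r : σ → ℝ≥0∞}

theorem enorm_coeff_mul_le_wnorm (f : MvPowerSeries σ ℂ) (α : σ →₀ ℕ) :
    ‖coeff α f‖ₑ * α.prod (fun i k => r i ^ k) ≤ wnorm r f :=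
  ENNReal.le_tsum (f := fun α : σ →₀ ℕ => ‖coeff α f‖ₑ * α.prod (fun i k => r i ^ k)) α

theorem wnorm_mono {r' : σ → ℝ≥0∞} (h : ∀ i, r i ≤ r' i) (f : MvPowerSeries σ ℂ) :
    wnorm r f ≤ wnorm r' f := by
  refine ENNReal.tsum_le_tsum fun α => ?_
  unfold Finsupp.prod
  gcongr with i
  exact pow_le_pow_left' (h i) _

theorem wnorm_zero : wnorm r (0 : MvPowerSeries σ ℂ) = 0 := by simp [wnorm]

theorem wnorm_add_le (f g : MvPowerSeries σ ℂ) : wnorm r (f + g) ≤ wnorm r f + wnorm r g := by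
  unfold wnorm
  rw [← ENNReal.tsum_add]
  refine ENNReal.tsum_le_tsum fun α => ?_
  rw [map_add, ← add_mul]
  gcongr
  exact enorm_add_le _ _

theorem wnorm_neg (f : MvPowerSeries σ ℂ) : wnorm r (-f) = wnorm r f := by
  simp [wnorm]

theorem wnorm_sub_le (f g : MvPowerSeries σ ℂ) : wnorm r (f - g) ≤ wnorm r f + wnorm r g := by
  rw [sub_eq_add_neg, ← wnorm_neg g]
  exact wnorm_add_le _ _

theorem wnorm_monomial (α : σ →₀ ℕ) (c : ℂ) :
    wnorm r (monomial α c) = ‖c‖ₑ * α.prod (fun i k => r i ^ k) := by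
  classical
  unfold wnorm
  rw [tsum_eq_single α]
  · rw [coeff_monomial_same]
  · intro β hβ
    rw [coeff_monomial_ne hβ, enorm_zero, zero_mul]

theorem wnorm_C (c : ℂ) : wnorm r (C c : MvPowerSeries σ ℂ) = ‖c‖ₑ := by
  rw [← monomial_zero_eq_C_apply, wnorm_monomial]; simp

theorem wnorm_one : wnorm r (1 : MvPowerSeries σ ℂ) = 1 := by
  rw [← map_one C, wnorm_C]; simp

theorem wnorm_X (i : σ) : wnorm r (X i : MvPowerSeries σ ℂ) = r i := by
  rw [X_def, wnorm_monomial]; simp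

theorem wnorm_mul_le (f g : MvPowerSeries σ ℂ) : wnorm r (f * g) ≤ wnorm r f * wnorm r g := by
  classical
  have key : wnorm r f * wnorm r g = ∑' α : σ →₀ ℕ, ∑ p ∈ Finset.HasAntidiagonal.antidiagonal α,
      (‖coeff p.1 f‖ₑ * p.1.prod (fun i k => r i ^ k)) *
        (‖coeff p.2 g‖ₑ * p.2.prod (fun i k => r i ^ k)) := by
    unfold wnorm
    simp_rw [← ENNReal.tsum_mul_right, ← ENNReal.tsum_mul_left]
    rw [← ENNReal.tsum_prod (f := fun α β : σ →₀ ℕ =>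
      (‖coeff α f‖ₑ * α.prod (fun i k => r i ^ k)) *
        (‖coeff β g‖ₑ * β.prod (fun i k => r i ^ k))),
      ← Finset.HasAntidiagonal.sigmaAntidiagonalEquivProd.tsum_eq, ENNReal.tsum_sigma']
    refine tsum_congr fun α => ?_
    rw [tsum_fintype]
    exact Finset.sum_coe_sort (Finset.HasAntidiagonal.antidiagonal α)
      fun p => (‖coeff p.1 f‖ₑ * p.1.prod (fun i k => r i ^ k)) *
        (‖coeff p.2 g‖ₑ * p.2.prod (fun i k => r i ^ k))
  rw [key]
  refine ENNReal.tsum_le_tsum fun α => ?_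
  rw [coeff_mul]
  calc _ ≤ (∑ p ∈ Finset.HasAntidiagonal.antidiagonal α, ‖coeff p.1 f * coeff p.2 g‖ₑ) *
        α.prod (fun i k => r i ^ k) := by
        gcongr; exact enorm_sum_le _ _
    _ = _ := by
        rw [Finset.sum_mul]
        refine Finset.sum_congr rfl fun p hp => ?_
        rw [← Finset.HasAntidiagonal.mem_antidiagonal.mp hp, enorm_mul, Finsupp.prod_add_index' (by simp)
          (by intros; rw [pow_add])]
        ring

theorem wnorm_pow_le (f : MvPowerSeries σ ℂ) (n : ℕ) : wnorm r (f ^ n) ≤ wnorm r f ^ n := by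
  induction n with
  | zero => simp [wnorm_one]
  | succ n ih =>
    rw [pow_succ, pow_succ]
    exact (wnorm_mul_le _ _).trans (by gcongr)

theorem wnorm_prod_le {ι : Type*} (s : Finset ι) (f : ι → MvPowerSeries σ ℂ) :
    wnorm r (∏ i ∈ s, f i) ≤ ∏ i ∈ s, wnorm r (f i) := by
  classical
  induction s using Finset.induction_on with
  | empty => simp [wnorm_one]
  | insert a s ha ih =>
    rw [Finset.prod_insert ha, Finset.prod_insert ha]
    exact (wnorm_mul_le _ _).trans (by gcongr)

theorem wnorm_finsuppProd_le (g : τ → MvPowerSeries σ ℂ) (d : τ →₀ ℕ) :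
    wnorm r (d.prod fun i k => g i ^ k) ≤ d.prod fun i k => wnorm r (g i) ^ k := by
  unfold Finsupp.prod
  exact (wnorm_prod_le _ _).trans (Finset.prod_le_prod' fun i _ => wnorm_pow_le _ _)

theorem coeff_subst_eq_tsum {g : τ → MvPowerSeries σ ℂ} (hg : HasSubst g) (f : MvPowerSeries τ ℂ)
    (e : σ →₀ ℕ) : coeff e (subst g f) =
      ∑' d : τ →₀ ℕ, coeff d f * coeff e (d.prod fun i k => g i ^ k) := by
  rw [coeff_subst hg]
  exact (tsum_eq_finsum (coeff_subst_finite hg f e)).symm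

theorem enorm_coeff_subst_le {g : τ → MvPowerSeries σ ℂ} (hg : HasSubst g)
    (f : MvPowerSeries τ ℂ) (e : σ →₀ ℕ) : ‖coeff e (subst g f)‖ₑ ≤
      ∑' d : τ →₀ ℕ, ‖coeff d f‖ₑ * ‖coeff e (d.prod fun i k => g i ^ k)‖ₑ := by
  rw [coeff_subst hg, finsum_eq_sum _ (coeff_subst_finite hg f e)]
  refine (enorm_sum_le _ _).trans ?_
  simp_rw [smul_eq_mul, enorm_mul]
  exact ENNReal.sum_le_tsum _

/-- The triangle inequality is applied to the expansion `∑ f_d g^d`. With values in `[0, ∞]` the two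
sums may be exchanged with no convergence hypothesis, so the bound can later be used to prove
convergence. -/
theorem wnorm_subst_le {g : τ → MvPowerSeries σ ℂ} (hg : HasSubst g) (f : MvPowerSeries τ ℂ) :
    wnorm r (subst g f) ≤ wnorm (fun i => wnorm r (g i)) f := by
  calc wnorm r (subst g f) ≤ ∑' e : σ →₀ ℕ, ∑' d : τ →₀ ℕ, ‖coeff d f‖ₑ *
        (‖coeff e (d.prod fun i k => g i ^ k)‖ₑ * e.prod (fun i k => r i ^ k)) := by
        refine ENNReal.tsum_le_tsum fun e => ?_
        simp_rw [← mul_assoc]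
        rw [ENNReal.tsum_mul_right]
        gcongr
        exact enorm_coeff_subst_le hg f e
    _ = ∑' d : τ →₀ ℕ, ‖coeff d f‖ₑ * wnorm r (d.prod fun i k => g i ^ k) := by
        rw [ENNReal.tsum_comm]
        simp_rw [ENNReal.tsum_mul_left]
        rfl
    _ ≤ _ := by
        refine ENNReal.tsum_le_tsum fun d => ?_
        gcongr
        exact wnorm_finsuppProd_le g d

/-- Scaling of the weights: a gain of `t ^ m` if all monomials of `f` have weight at least `m`. -/
theorem wnorm_scale_le (w : σ → ℕ) (m : ℕ) (t : ℝ≥0∞) (ht : t ≤ 1) (f : MvPowerSeries σ ℂ)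
    (hf : ∀ α, Finsupp.weight w α < m → coeff α f = 0) :
    wnorm (fun i => t ^ w i * r i) f ≤ t ^ m * wnorm r f := by
  unfold wnorm
  rw [← ENNReal.tsum_mul_left]
  refine ENNReal.tsum_le_tsum fun α => ?_
  by_cases h : Finsupp.weight w α < m
  · simp [hf α h]
  · have : (α.prod fun i k => (t ^ w i * r i) ^ k) =
        t ^ Finsupp.weight w α * α.prod fun i k => r i ^ k := by
      simp only [Finsupp.prod, mul_pow, Finset.prod_mul_distrib, Finsupp.weight_apply,
        Finsupp.sum, ← pow_mul, ← Finset.prod_pow_eq_pow_sum, smul_eq_mul]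
      congr 1
      exact Finset.prod_congr rfl fun i _ => by rw [mul_comm]
    rw [this]
    calc _ ≤ ‖coeff α f‖ₑ * (t ^ m * α.prod fun i k => r i ^ k) := by
          gcongr ‖coeff α f‖ₑ * (?_ * _)
          exact pow_le_pow_right_of_le_one' ht (not_lt.mp h)
      _ = _ := by ring

end wnorm

/-- Each finite set of exponents lies in a box, over which the sum factors into partial sums of
geometric series. -/
theorem tsum_prod_pow_lt_top {σ : Type*} [Finite σ] {q : ℝ≥0∞} (hq : q < 1) :
    ∑' α : σ →₀ ℕ, α.prod (fun _ k => q ^ k) < ⊤ := by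
  classical
  have := Fintype.ofFinite σ
  refine lt_of_le_of_lt (b := ∏ _i : σ, (1 - q)⁻¹) ?_
    (ENNReal.prod_lt_top fun _ _ => ENNReal.inv_lt_top.mpr (tsub_pos_of_lt hq))
  rw [ENNReal.tsum_eq_iSup_sum]
  refine iSup_le fun S => ?_
  obtain ⟨N, hN⟩ : ∃ N, ∀ α ∈ S, ∀ i, α i < N := by
    refine ⟨(S.sup fun α => α.degree) + 1, fun α hα i => ?_⟩
    exact Nat.lt_succ_of_le ((Finsupp.le_degree i α).trans
      (Finset.le_sup (f := fun α : σ →₀ ℕ => α.degree) hα))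
  calc ∑ α ∈ S, α.prod (fun _ k => q ^ k)
      = ∑ f ∈ S.image (fun α : σ →₀ ℕ => (α : σ → ℕ)), ∏ i, q ^ f i := by
        rw [Finset.sum_image fun _ _ _ _ h => DFunLike.coe_injective h]
        exact Finset.sum_congr rfl fun α _ => Finsupp.prod_fintype _ _ (by simp)
    _ ≤ ∑ f ∈ Fintype.piFinset fun _ : σ => Finset.range N, ∏ i, q ^ f i := by
        refine Finset.sum_le_sum_of_subset fun f hf => ?_
        obtain ⟨α, hα, rfl⟩ := Finset.mem_image.mp hf
        simpa using hN α hα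
    _ = ∏ _i : σ, ∑ k ∈ Finset.range N, q ^ k := by rw [Finset.prod_univ_sum]
    _ ≤ _ := by
        refine Finset.prod_le_prod' fun i _ => ?_
        rw [← ENNReal.tsum_geometric]
        exact ENNReal.sum_le_tsum _

/-! ### Convergence as finiteness of a weighted norm, and its closure properties -/

section convergence

variable {σ τ : Type*}

theorem isConvergent_of_wnorm_lt_top [Finite σ] {r : σ → ℝ≥0∞} (hr : ∀ i, r i ≠ 0)
    {f : MvPowerSeries σ ℂ} (hf : wnorm r f < ⊤) : IsConvergent f := by
  obtain ⟨ε, hε, hεr⟩ : ∃ ε : ℝ≥0, 0 < ε ∧ ∀ i, (ε : ℝ≥0∞) ≤ r i := by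
    have : ∀ᶠ ε : ℝ≥0 in 𝓝[>] 0, ∀ i, (ε : ℝ≥0∞) ≤ r i := by
      rw [eventually_all]
      intro i
      have h : Tendsto (fun ε : ℝ≥0 => (ε : ℝ≥0∞)) (𝓝[>] 0) (𝓝 0) :=
        (ENNReal.tendsto_coe.mpr tendsto_id).mono_left nhdsWithin_le_nhds
      exact h.eventually_le_const (pos_iff_ne_zero.mpr (hr i))
    exact ((eventually_mem_nhdsWithin).and this).exists
  have hM : wnorm (fun _ => (ε : ℝ≥0∞)) f < ⊤ := (wnorm_mono hεr f).trans_lt hf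
  refine ⟨(wnorm (fun _ => (ε : ℝ≥0∞)) f).toReal + 1, by positivity, ε, by exact_mod_cast hε,
    fun α => ?_⟩
  have h1 := enorm_coeff_mul_le_wnorm (r := fun _ => (ε : ℝ≥0∞)) f α
  have h2 : (α.prod fun _ k => (ε : ℝ≥0∞) ^ k) = (ε : ℝ≥0∞) ^ α.degree := by
    rw [Finsupp.prod, Finset.prod_pow_eq_pow_sum]; rfl
  rw [h2] at h1
  have h3 := ENNReal.toReal_mono hM.ne h1
  rw [ENNReal.toReal_mul, toReal_enorm, ENNReal.toReal_pow, ENNReal.coe_toReal] at h3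
  have h4 : (0 : ℝ) < (ε : ℝ) ^ α.degree := by positivity
  rw [inv_pow, ← div_eq_mul_inv, le_div_iff₀ h4]
  linarith

theorem IsConvergent.exists_wnorm_lt_top [Finite σ] {f : MvPowerSeries σ ℂ}
    (hf : IsConvergent f) : ∃ r : ℝ≥0, 0 < r ∧ wnorm (fun _ => (r : ℝ≥0∞)) f < ⊤ := by
  obtain ⟨C, hC, r, hr, h⟩ := hf
  lift r to ℝ≥0 using hr.le
  lift C to ℝ≥0 using hC.le
  have hr' : 0 < r := by exact_mod_cast hr
  -- Halving the radius turns the Cauchy estimate into a geometric majorant of ratio `1/2`.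
  refine ⟨r * 2⁻¹, by positivity, ?_⟩
  have h2 : (2⁻¹ : ℝ≥0∞) < 1 := ENNReal.inv_lt_one.mpr (by norm_num)
  refine lt_of_le_of_lt (b := (C : ℝ≥0∞) * ∑' α : σ →₀ ℕ, α.prod (fun _ k => (2⁻¹ : ℝ≥0∞) ^ k)) ?_
    (ENNReal.mul_lt_top (by simp) (tsum_prod_pow_lt_top h2))
  unfold wnorm
  rw [← ENNReal.tsum_mul_left]
  refine ENNReal.tsum_le_tsum fun α => ?_
  have h3 : ‖coeff α f‖ₑ ≤ C * (r : ℝ≥0∞)⁻¹ ^ α.degree := by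
    have := h α
    rw [← ENNReal.coe_inv hr'.ne', ← ENNReal.coe_pow, ← ENNReal.coe_mul]
    rw [enorm_le_coe]
    exact_mod_cast this
  have h4 : (α.prod fun _ k => ((r * 2⁻¹ : ℝ≥0) : ℝ≥0∞) ^ k) =
      (r : ℝ≥0∞) ^ α.degree * α.prod (fun _ k => (2⁻¹ : ℝ≥0∞) ^ k) := by
    simp only [Finsupp.prod, Finset.prod_pow_eq_pow_sum, ENNReal.coe_mul, mul_pow,
      Finset.prod_mul_distrib]
    rw [ENNReal.coe_inv (by norm_num)]
    rfl
  rw [h4]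
  calc _ ≤ C * (r : ℝ≥0∞)⁻¹ ^ α.degree * ((r : ℝ≥0∞) ^ α.degree *
        α.prod (fun _ k => (2⁻¹ : ℝ≥0∞) ^ k)) := by gcongr
    _ = C * (((r : ℝ≥0∞)⁻¹ * r) ^ α.degree) * α.prod (fun _ k => (2⁻¹ : ℝ≥0∞) ^ k) := by
        rw [mul_pow]; ring
    _ = _ := by
        rw [ENNReal.inv_mul_cancel (by exact_mod_cast hr'.ne') (by simp), one_pow, mul_one]

theorem IsConvergent.eventually_wnorm_lt_top [Finite σ] {f : MvPowerSeries σ ℂ}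
    (hf : IsConvergent f) : ∀ᶠ r : ℝ≥0 in 𝓝 0, wnorm (fun _ => (r : ℝ≥0∞)) f < ⊤ := by
  obtain ⟨r, hr, h⟩ := hf.exists_wnorm_lt_top
  filter_upwards [eventually_le_nhds hr] with s hs
  exact (wnorm_mono (fun _ => by exact_mod_cast hs) f).trans_lt h

theorem wnorm_smul_le_of_constantCoeff_eq_zero {r : σ → ℝ≥0∞} {t : ℝ≥0∞} (ht : t ≤ 1)
    {f : MvPowerSeries σ ℂ} (h0 : constantCoeff f = 0) :
    wnorm (fun i => t * r i) f ≤ t * wnorm r f := by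
  have := wnorm_scale_le (r := r) (fun _ => 1) 1 t ht f fun α hα => ?_
  · simpa using this
  · have : α = 0 := by
      have h1 : Finsupp.weight (fun _ => 1) α = α.degree := by
        rw [Finsupp.degree_eq_weight_one]
      rwa [h1, Nat.lt_one_iff, Finsupp.degree_eq_zero_iff] at hα
    rw [this, coeff_zero_eq_constantCoeff_apply, h0]

/-- Without a constant term the norm decays at least linearly in the radius. This is what makes
substitution into a convergent series legitimate at small radii. -/
theorem IsConvergent.eventually_wnorm_le [Finite σ] {f : MvPowerSeries σ ℂ}
    (hf : IsConvergent f) (h0 : constantCoeff f = 0) {ε : ℝ≥0∞} (hε : ε ≠ 0) :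
    ∀ᶠ r : ℝ≥0 in 𝓝 0, wnorm (fun _ => (r : ℝ≥0∞)) f ≤ ε := by
  obtain ⟨r, hr, h⟩ := hf.exists_wnorm_lt_top
  have h1 : Tendsto (fun s : ℝ≥0 => (((s / r : ℝ≥0)) : ℝ≥0∞) * wnorm (fun _ => (r : ℝ≥0∞)) f)
      (𝓝 0) (𝓝 0) := by
    have : Tendsto (fun s : ℝ≥0 => (((s / r : ℝ≥0)) : ℝ≥0∞)) (𝓝 0) (𝓝 0) := by
      rw [← ENNReal.coe_zero, ENNReal.tendsto_coe]
      simpa using (tendsto_id (α := ℝ≥0) (x := 𝓝 0)).div_const r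
    simpa using ENNReal.Tendsto.mul_const this (Or.inr h.ne)
  filter_upwards [h1.eventually_le_const (pos_iff_ne_zero.mpr hε), eventually_le_nhds hr]
    with s hs hsr
  refine le_trans ?_ hs
  have h2 := wnorm_smul_le_of_constantCoeff_eq_zero (r := fun _ : σ => (r : ℝ≥0∞))
    (t := ((s / r : ℝ≥0) : ℝ≥0∞)) (by exact_mod_cast div_le_one_of_le₀ hsr (by positivity)) h0
  refine le_trans (le_of_eq ?_) h2
  congr 1
  funext _
  rw [← ENNReal.coe_mul, div_mul_cancel₀ _ hr.ne']

theorem isConvergent_of_eventually [Finite σ] {f : MvPowerSeries σ ℂ}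
    (h : ∀ᶠ r : ℝ≥0 in 𝓝 0, wnorm (fun _ => (r : ℝ≥0∞)) f < ⊤) : IsConvergent f := by
  obtain ⟨r, hr, h⟩ := ((eventually_mem_nhdsWithin (a := (0 : ℝ≥0)) (s := Set.Ioi 0)).and
    (h.filter_mono nhdsWithin_le_nhds)).exists
  exact isConvergent_of_wnorm_lt_top (fun _ => by simpa using ne_of_gt hr) h

variable [Finite σ]

theorem isConvergent_X (i : σ) : IsConvergent (X i : MvPowerSeries σ ℂ) :=
  isConvergent_of_eventually (by simp [wnorm_X])

theorem isConvergent_C (c : ℂ) : IsConvergent (C c : MvPowerSeries σ ℂ) :=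
  isConvergent_of_eventually (by simp [wnorm_C])

theorem isConvergent_zero : IsConvergent (0 : MvPowerSeries σ ℂ) :=
  isConvergent_of_eventually (by simp [wnorm_zero])

theorem IsConvergent.add {f g : MvPowerSeries σ ℂ} (hf : IsConvergent f) (hg : IsConvergent g) :
    IsConvergent (f + g) := by
  refine isConvergent_of_eventually ?_
  filter_upwards [hf.eventually_wnorm_lt_top, hg.eventually_wnorm_lt_top] with r h1 h2
  exact (wnorm_add_le _ _).trans_lt (ENNReal.add_lt_top.mpr ⟨h1, h2⟩)

theorem IsConvergent.neg {f : MvPowerSeries σ ℂ} (hf : IsConvergent f) : IsConvergent (-f) :=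
  isConvergent_of_eventually (by simpa [wnorm_neg] using hf.eventually_wnorm_lt_top)

theorem IsConvergent.sub {f g : MvPowerSeries σ ℂ} (hf : IsConvergent f) (hg : IsConvergent g) :
    IsConvergent (f - g) := by
  rw [sub_eq_add_neg]; exact hf.add hg.neg

theorem IsConvergent.mul {f g : MvPowerSeries σ ℂ} (hf : IsConvergent f) (hg : IsConvergent g) :
    IsConvergent (f * g) := by
  refine isConvergent_of_eventually ?_
  filter_upwards [hf.eventually_wnorm_lt_top, hg.eventually_wnorm_lt_top] with r h1 h2
  exact (wnorm_mul_le _ _).trans_lt (ENNReal.mul_lt_top h1 h2)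

theorem IsConvergent.pow {f : MvPowerSeries σ ℂ} (hf : IsConvergent f) (k : ℕ) :
    IsConvergent (f ^ k) := by
  induction k with
  | zero => rw [pow_zero, ← map_one C]; exact isConvergent_C 1
  | succ k ih => rw [pow_succ]; exact ih.mul hf

theorem IsConvergent.sum {ι : Type*} (s : Finset ι) {f : ι → MvPowerSeries σ ℂ}
    (hf : ∀ i ∈ s, IsConvergent (f i)) : IsConvergent (∑ i ∈ s, f i) := by
  classical
  induction s using Finset.induction_on with
  | empty => simpa using isConvergent_zero
  | insert a s ha ih =>
    rw [Finset.sum_insert ha]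
    exact (hf a (by simp)).add (ih fun i hi => hf i (by simp [hi]))

theorem IsConvergent.subst [Finite τ] {f : MvPowerSeries τ ℂ} (hf : IsConvergent f)
    {g : τ → MvPowerSeries σ ℂ} (hg : ∀ i, IsConvergent (g i))
    (hg0 : ∀ i, constantCoeff (g i) = 0) : IsConvergent (subst g f) := by
  obtain ⟨R, hR, h⟩ := hf.exists_wnorm_lt_top
  refine isConvergent_of_eventually ?_
  have := eventually_all.mpr fun i => (hg i).eventually_wnorm_le (hg0 i)
    (ε := (R : ℝ≥0∞)) (by simpa using hR.ne')
  filter_upwards [this] with r hr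
  exact ((wnorm_subst_le (hasSubst_of_constantCoeff_zero hg0) f).trans
    (wnorm_mono hr f)).trans_lt h

theorem IsConvergent.rename [Finite τ] {f : MvPowerSeries τ ℂ} (hf : IsConvergent f)
    (e : τ → σ) [TendstoCofinite e] : IsConvergent (rename e f) := by
  rw [rename_eq_subst]
  exact hf.subst (fun i => isConvergent_X _) (fun i => by simp)

omit [Finite σ] in
theorem IsConvergent.conjSeries {f : MvPowerSeries σ ℂ} (hf : IsConvergent f) :
    IsConvergent (conjSeries f) := by
  obtain ⟨C, hC, r, hr, h⟩ := hf
  exact ⟨C, hC, r, hr, fun α => by simpa [FormalCR.conjSeries] using h α⟩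

omit [Finite σ] in
theorem isConvergent_of_X_pow_mul {f : MvPowerSeries σ ℂ} (i : σ) (k : ℕ)
    (hf : IsConvergent (X i ^ k * f)) : IsConvergent f := by
  classical
  obtain ⟨C, hC, r, hr, h⟩ := hf
  refine ⟨C * r⁻¹ ^ k, by positivity, r, hr, fun α => ?_⟩
  have := h (Finsupp.single i k + α)
  rw [X_pow_eq, coeff_add_monomial_mul, one_mul, map_add, Finsupp.degree_single, pow_add,
    ← mul_assoc] at this
  exact this

omit [Finite σ] in
theorem IsConvergent.pderiv {f : MvPowerSeries σ ℂ} (hf : IsConvergent f) (i : σ) :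
    IsConvergent (pderiv ℂ i f) := by
  obtain ⟨C, hC, r, hr, h⟩ := hf
  -- The factor `α i + 1` produced by differentiation is at most `2 ^ |α|`, which halving the radius
  -- absorbs.
  refine ⟨C * r⁻¹, by positivity, r / 2, by positivity, fun α => ?_⟩
  rw [coeff_pderiv, norm_mul]
  have h1 := h (α + Finsupp.single i 1)
  rw [map_add, Finsupp.degree_single, pow_add, pow_one] at h1
  have h2 : ‖((α i : ℂ) + 1)‖ ≤ 2 ^ α.degree := by
    have h3 : α i + 1 ≤ 2 ^ α.degree :=
      (Nat.succ_le_of_lt Nat.lt_two_pow_self).trans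
        (Nat.pow_le_pow_right (by norm_num) (Finsupp.le_degree i α))
    calc ‖((α i : ℂ) + 1)‖ = ((α i + 1 : ℕ) : ℝ) := by
          rw [← Nat.cast_one (R := ℂ), ← Nat.cast_add, Complex.norm_natCast]
      _ ≤ _ := by exact_mod_cast h3
  calc _ ≤ C * (r⁻¹ ^ α.degree * r⁻¹) * 2 ^ α.degree := by gcongr
    _ = _ := by rw [div_eq_mul_inv, mul_inv, inv_inv, mul_pow]; ring

end convergence

/-! ### Formal calculus: congruences, Hadamard's lemma, chain rule -/

section formal

variable {σ τ : Type*}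

theorem constantCoeff_subst_of_zero [Finite τ] {g : τ → MvPowerSeries σ ℂ}
    (hg : ∀ i, constantCoeff (g i) = 0) (f : MvPowerSeries τ ℂ) :
    constantCoeff (subst g f) = constantCoeff f := by
  have hs := hasSubst_of_constantCoeff_zero hg
  have h := constantCoeff_subst_eq_zero hs hg (f := f - C (constantCoeff f)) (by simp)
  rw [subst_sub hs, subst_C, map_sub, constantCoeff_C, sub_eq_zero] at h
  exact h

/-- The series whose coefficients vanish on a lower set of exponents form an ideal, and agreement on
the lower set is congruence modulo it. The sets used below encode truncation by degree, truncation
in one variable, and setting a variable equal to `0`. -/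
theorem coeff_mul_congr {D : Set (σ →₀ ℕ)} (hD : IsLowerSet D) {f f' g g' : MvPowerSeries σ ℂ}
    (hf : ∀ α ∈ D, coeff α f = coeff α f') (hg : ∀ α ∈ D, coeff α g = coeff α g') :
    ∀ α ∈ D, coeff α (f * g) = coeff α (f' * g') := by
  classical
  intro α hα
  rw [coeff_mul, coeff_mul]
  refine Finset.sum_congr rfl fun p hp => ?_
  rw [Finset.HasAntidiagonal.mem_antidiagonal] at hp
  rw [hf p.1 (hD (hp ▸ le_self_add) hα), hg p.2 (hD (hp ▸ le_add_self) hα)]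

theorem coeff_pow_congr {D : Set (σ →₀ ℕ)} (hD : IsLowerSet D) {f f' : MvPowerSeries σ ℂ}
    (hf : ∀ α ∈ D, coeff α f = coeff α f') (k : ℕ) :
    ∀ α ∈ D, coeff α (f ^ k) = coeff α (f' ^ k) := by
  induction k with
  | zero => simp
  | succ k ih => simpa [pow_succ] using coeff_mul_congr hD ih hf

theorem coeff_subst_congr {D : Set (σ →₀ ℕ)} (hD : IsLowerSet D) {g g' : τ → MvPowerSeries σ ℂ}
    (hg : HasSubst g) (hg' : HasSubst g') (h : ∀ i, ∀ α ∈ D, coeff α (g i) = coeff α (g' i))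
    (f : MvPowerSeries τ ℂ) : ∀ α ∈ D, coeff α (subst g f) = coeff α (subst g' f) := by
  classical
  have hp : ∀ (d : τ →₀ ℕ) (s : Finset τ), ∀ α ∈ D,
      coeff α (∏ i ∈ s, g i ^ d i) = coeff α (∏ i ∈ s, g' i ^ d i) := by
    intro d s
    induction s using Finset.induction_on with
    | empty => simp
    | insert a s ha ih =>
      rw [Finset.prod_insert ha, Finset.prod_insert ha]
      exact coeff_mul_congr hD (coeff_pow_congr hD (h a) _) ih
  intro α hα
  rw [coeff_subst hg, coeff_subst hg']
  refine finsum_congr fun d => ?_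
  rw [Finsupp.prod, Finsupp.prod, hp d d.support α hα]

theorem coeff_X_mul' [DecidableEq σ] (i : σ) (f : MvPowerSeries σ ℂ) (α : σ →₀ ℕ) :
    coeff α (X i * f) = if α i = 0 then 0 else coeff (α - Finsupp.single i 1) f := by
  rw [X_def, coeff_monomial_mul, one_mul]
  simp only [Finsupp.single_le_iff, Nat.one_le_iff_ne_zero, ne_eq, ite_not]

/-- A power series all of whose monomials contain a variable from `S` is a combination of these
variables. -/
theorem exists_eq_sum_X_mul (S : Finset σ) (E : MvPowerSeries σ ℂ)
    (hE : ∀ α : σ →₀ ℕ, (∀ i ∈ S, α i = 0) → coeff α E = 0) :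
    ∃ U : σ → MvPowerSeries σ ℂ, E = ∑ i ∈ S, X i * U i ∧
      ∀ i ∈ S, constantCoeff (U i) = coeff (Finsupp.single i 1) E := by
  classical
  induction S using Finset.induction_on generalizing E with
  | empty => exact ⟨0, by ext α; simpa using hE α, by simp⟩
  | insert a S ha ih =>
    -- `X a * V` collects exactly the monomials of `E` that contain `X a`; the rest is left to the
    -- variables of `S`.
    let V : MvPowerSeries σ ℂ := fun α => coeff (α + Finsupp.single a 1) E
    have hV : ∀ α, coeff α V = coeff (α + Finsupp.single a 1) E := fun _ => rfl
    have hXV : ∀ α : σ →₀ ℕ, coeff α (X a * V) = if α a = 0 then 0 else coeff α E := by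
      intro α
      rw [coeff_X_mul', hV]
      split_ifs with h
      · rfl
      · rw [tsub_add_cancel_of_le (by simpa [Nat.one_le_iff_ne_zero] using h)]
    obtain ⟨U, hU, hU0⟩ := ih (E - X a * V) fun α hα => by
      rw [map_sub, hXV]
      split_ifs with h
      · rw [sub_zero]
        refine hE α fun i hi => ?_
        rcases Finset.mem_insert.mp hi with rfl | hi
        · exact h
        · exact hα i hi
      · rw [sub_self]
    refine ⟨Function.update U a V, ?_, ?_⟩
    · rw [Finset.sum_insert ha, Function.update_self, add_comm, ← sub_eq_iff_eq_add, hU]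
      refine Finset.sum_congr rfl fun i hi => ?_
      rw [Function.update_of_ne (ne_of_mem_of_not_mem hi ha)]
    · intro i hi
      rcases Finset.mem_insert.mp hi with rfl | hi
      · rw [Function.update_self, ← coeff_zero_eq_constantCoeff_apply, hV, zero_add]
      · have hne := ne_of_mem_of_not_mem hi ha
        rw [Function.update_of_ne hne, hU0 i hi, map_sub, hXV, if_pos (by simp [hne]), sub_zero]

theorem exists_eq_C_add_sum [Fintype σ] (f : MvPowerSeries σ ℂ) :
    ∃ U : σ → MvPowerSeries σ ℂ, f = C (constantCoeff f) + ∑ i, X i * U i ∧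
      ∀ i, constantCoeff (U i) = coeff (Finsupp.single i 1) f := by
  classical
  obtain ⟨U, hU, hU0⟩ := exists_eq_sum_X_mul Finset.univ (f - C (constantCoeff f)) fun α hα => by
    have : α = 0 := Finsupp.ext fun i => hα i (Finset.mem_univ i)
    simp [this]
  refine ⟨U, by rw [← hU]; ring, fun i => ?_⟩
  rw [hU0 i (Finset.mem_univ i), map_sub, coeff_C_of_ne_zero (by simp), sub_zero]

theorem coeff_single_eq_constantCoeff_pderiv (j : σ) (h : MvPowerSeries σ ℂ) :
    coeff (Finsupp.single j 1) h = constantCoeff (pderiv ℂ j h) := by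
  rw [← coeff_zero_eq_constantCoeff_apply, coeff_pderiv]; simp

theorem coeff_single_mul_of_zero (j : σ) {f g : MvPowerSeries σ ℂ} (hf : constantCoeff f = 0) :
    coeff (Finsupp.single j 1) (f * g) = coeff (Finsupp.single j 1) f * constantCoeff g := by
  rw [coeff_single_eq_constantCoeff_pderiv, coeff_single_eq_constantCoeff_pderiv,
    Derivation.leibniz]
  simp [hf, mul_comm]

theorem coeff_single_subst [Fintype τ] {g : τ → MvPowerSeries σ ℂ}
    (hg : ∀ i, constantCoeff (g i) = 0) (f : MvPowerSeries τ ℂ) (j : σ) :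
    coeff (Finsupp.single j 1) (subst g f) =
      ∑ i, coeff (Finsupp.single i 1) f * coeff (Finsupp.single j 1) (g i) := by
  have hs := hasSubst_of_constantCoeff_zero hg
  obtain ⟨U, hU, hU0⟩ := exists_eq_C_add_sum f
  conv_lhs => rw [hU]
  rw [← coe_substAlgHom hs, map_add, map_sum, coe_substAlgHom, subst_C, map_add,
    coeff_C_of_ne_zero (by simp), zero_add, map_sum]
  refine Finset.sum_congr rfl fun i _ => ?_
  rw [subst_mul hs, subst_X hs, coeff_single_mul_of_zero j (hg i),
    constantCoeff_subst_of_zero hg, hU0, mul_comm]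

/-- Hadamard's lemma for substitutions. -/
theorem exists_subst_sub_subst_eq [Fintype τ] {g g' : τ → MvPowerSeries σ ℂ}
    (hg : ∀ i, constantCoeff (g i) = 0) (hg' : ∀ i, constantCoeff (g' i) = 0)
    (f : MvPowerSeries τ ℂ) :
    ∃ U : τ → MvPowerSeries σ ℂ, subst g f - subst g' f = ∑ i, U i * (g i - g' i) ∧
      ∀ i, constantCoeff (U i) = coeff (Finsupp.single i 1) f := by
  classical
  -- Universal case: in independent variables `x, z`, every monomial of `f(x + z) - f(x)` contains
  -- some `z_i`. The general case follows on substituting `x = g'`, `z = g - g'`.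
  let p : τ → MvPowerSeries (τ ⊕ τ) ℂ := fun i => X (Sum.inl i) + X (Sum.inr i)
  let q : τ → MvPowerSeries (τ ⊕ τ) ℂ := fun i => X (Sum.inl i)
  have hp : ∀ i, constantCoeff (p i) = 0 := fun i => by simp [p]
  have hq : ∀ i, constantCoeff (q i) = 0 := fun i => by simp [q]
  have hps := hasSubst_of_constantCoeff_zero hp
  have hqs := hasSubst_of_constantCoeff_zero hq
  obtain ⟨U, hU, hU0⟩ := exists_eq_sum_X_mul (Finset.univ.map Function.Embedding.inr)
    (subst p f - subst q f) fun α hα => by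
      rw [map_sub, sub_eq_zero]
      refine coeff_subst_congr (D := {α : τ ⊕ τ →₀ ℕ | ∀ i, α (Sum.inr i) = 0}) ?_ hps hqs ?_ f α
        fun i => hα _ (by simp)
      · intro α β hβα hα i
        exact Nat.le_zero.mp ((hβα _).trans (hα i).le)
      · intro i β hβ
        rw [map_add, coeff_X (s := Sum.inr i), if_neg, add_zero]
        rintro rfl
        simpa using hβ i
  let k : τ ⊕ τ → MvPowerSeries σ ℂ := Sum.elim g' (fun i => g i - g' i)
  have hk : ∀ i, constantCoeff (k i) = 0 := by rintro (i | i) <;> simp [k, hg, hg']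
  have hks := hasSubst_of_constantCoeff_zero hk
  refine ⟨fun i => subst k (U (Sum.inr i)), ?_, fun i => ?_⟩
  · have := congrArg (subst k) hU
    rw [subst_sub hks, subst_comp_subst_apply hps hks, subst_comp_subst_apply hqs hks,
      ← coe_substAlgHom hks, map_sum, Finset.sum_map] at this
    have e1 : (fun i => substAlgHom (R := ℂ) hks (p i)) = g := by
      funext i
      rw [map_add, substAlgHom_X, substAlgHom_X]
      simp [k]
    have e2 : (fun i => substAlgHom (R := ℂ) hks (q i)) = g' := by
      funext i
      rw [substAlgHom_X]
      rfl
    rw [e1, e2] at this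
    rw [this]
    refine Finset.sum_congr rfl fun i _ => ?_
    rw [map_mul, coe_substAlgHom, Function.Embedding.inr_apply, subst_X hks, mul_comm]
    rfl
  · rw [constantCoeff_subst_of_zero hk, hU0 _ (by simp), map_sub, coeff_single_subst hp,
      coeff_single_subst hq, ← Finset.sum_sub_distrib, Finset.sum_eq_single i]
    · simp [p, q, coeff_X, Finsupp.single_left_inj]
    · intro j _ hj
      simp [p, q, coeff_X, Finsupp.single_left_inj, hj.symm]
    · simp

/-- An additive map that behaves like multiplication by `g i` under multiplication with `X i`
and kills the constants vanishes. -/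
theorem addMonoidHom_eq_zero_of_X_mul [Finite σ] {g : σ → MvPowerSeries τ ℂ}
    (hg : ∀ i, constantCoeff (g i) = 0) (D : MvPowerSeries σ ℂ →+ MvPowerSeries τ ℂ)
    (hC : ∀ c, D (C c) = 0) (hX : ∀ i f, D (X i * f) = g i * D f) (f : MvPowerSeries σ ℂ) :
    D f = 0 := by
  classical
  have := Fintype.ofFinite σ
  have key : ∀ N, ∀ f, ∀ α : τ →₀ ℕ, α.degree < N → coeff α (D f) = 0 := by
    intro N
    induction N with
    | zero => simp
    | succ N ih =>
      intro f α hα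
      obtain ⟨U, hU, -⟩ := exists_eq_C_add_sum f
      -- Modulo constants `f = ∑ X_i U_i`, so `D f = ∑ g_i D(U_i)`; since `g_i(0) = 0`, the order of
      -- vanishing known for all values of `D` improves by one.
      rw [hU, map_add, hC, zero_add, map_sum, map_sum]
      refine Finset.sum_eq_zero fun i _ => ?_
      rw [hX, coeff_mul]
      refine Finset.sum_eq_zero fun p hp => ?_
      rw [Finset.HasAntidiagonal.mem_antidiagonal] at hp
      by_cases h : p.1 = 0
      · rw [h, coeff_zero_eq_constantCoeff_apply, hg, zero_mul]
      · rw [ih _ p.2, mul_zero]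
        have h1 : p.1.degree ≠ 0 := by rwa [ne_eq, Finsupp.degree_eq_zero_iff]
        have h2 : p.1.degree + p.2.degree = α.degree := by rw [← map_add, hp]
        omega
  ext α
  exact key _ f α (Nat.lt_succ_self _)

/-- The chain rule. -/
theorem pderiv_subst [Fintype σ] {g : σ → MvPowerSeries τ ℂ}
    (hg : ∀ i, constantCoeff (g i) = 0) (j : τ) (f : MvPowerSeries σ ℂ) :
    pderiv ℂ j (subst g f) = ∑ i, subst g (pderiv ℂ i f) * pderiv ℂ j (g i) := by
  classical
  have hs := hasSubst_of_constantCoeff_zero hg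
  -- The defect of the chain rule: the product rule makes it commute with multiplication by a
  -- variable in the sense required by `addMonoidHom_eq_zero_of_X_mul`.
  let D : MvPowerSeries σ ℂ →+ MvPowerSeries τ ℂ :=
    { toFun := fun f => pderiv ℂ j (subst g f) - ∑ i, subst g (pderiv ℂ i f) * pderiv ℂ j (g i)
      map_zero' := by simp only [← coe_substAlgHom hs, map_zero, zero_mul, Finset.sum_const_zero, sub_zero]
      map_add' := fun f f' => by
        simp only [← coe_substAlgHom hs, map_add, add_mul, Finset.sum_add_distrib]
        ring }
  have hD : D f = 0 := by
    refine addMonoidHom_eq_zero_of_X_mul hg D (fun c => ?_) (fun i f => ?_) f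
    · change pderiv ℂ j (subst g (C c)) - ∑ k, subst g (pderiv ℂ k (C c)) * pderiv ℂ j (g k) = 0
      simp only [subst_C, pderiv_C, ← coe_substAlgHom hs, map_zero, zero_mul,
        Finset.sum_const_zero, sub_zero]
    · change pderiv ℂ j (subst g (X i * f)) - ∑ k, subst g (pderiv ℂ k (X i * f)) *
        pderiv ℂ j (g k) = g i * (pderiv ℂ j (subst g f) -
          ∑ k, subst g (pderiv ℂ k f) * pderiv ℂ j (g k))
      simp only [← coe_substAlgHom hs, map_mul, Derivation.leibniz, smul_eq_mul, map_add,
        substAlgHom_X, pderiv_X, add_mul, Finset.sum_add_distrib]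
      have h1 : ∑ x, substAlgHom hs f * substAlgHom hs (Pi.single
          (M := fun _ => MvPowerSeries σ ℂ) x 1 i) * pderiv ℂ j (g x) =
          substAlgHom hs f * pderiv ℂ j (g i) := by
        rw [Finset.sum_eq_single i]
        · rw [Pi.single_eq_same, map_one, mul_one]
        · intro k _ hk
          rw [Pi.single_eq_of_ne hk.symm, map_zero, mul_zero, zero_mul]
        · simp
      rw [h1, mul_sub, Finset.mul_sum]
      simp only [mul_assoc]
      ring
  exact sub_eq_zero.mp hD

end formal

/-! ### A fixed point lemma for power series -/

section fixedPoint

variable {σ ι : Type*}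

/-- The iterates of `0` agree below weight `m` from the `m`-th on, so they have a coefficientwise
limit; norm bounds pass to it through finite partial sums. The weight `w` may be the degree or the
exponent of a single variable, and `B = ⊤` gives purely formal existence. -/
theorem exists_fixedPoint (w : (σ →₀ ℕ) → ℕ)
    (Φ : (ι → MvPowerSeries σ ℂ) → ι → MvPowerSeries σ ℂ)
    (h0 : ∀ Y, (∀ i, constantCoeff (Y i) = 0) → ∀ i, constantCoeff (Φ Y i) = 0)
    (hΦ : ∀ m Y Y', (∀ i, constantCoeff (Y i) = 0) → (∀ i, constantCoeff (Y' i) = 0) →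
      (∀ i α, w α < m → coeff α (Y i) = coeff α (Y' i)) →
      ∀ i α, w α < m + 1 → coeff α (Φ Y i) = coeff α (Φ Y' i))
    (r : σ → ℝ≥0∞) (B : ι → ℝ≥0∞)
    (hB : ∀ Y, (∀ i, constantCoeff (Y i) = 0) → (∀ i, wnorm r (Y i) ≤ B i) →
      ∀ i, wnorm r (Φ Y i) ≤ B i) :
    ∃ Y, (∀ i, constantCoeff (Y i) = 0) ∧ Φ Y = Y ∧ ∀ i, wnorm r (Y i) ≤ B i := by
  let Z : ℕ → ι → MvPowerSeries σ ℂ := fun m => Φ^[m] 0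
  have hZ : ∀ m, Z (m + 1) = Φ (Z m) := fun m => Function.iterate_succ_apply' Φ m 0
  have hZ0 : ∀ m i, constantCoeff (Z m i) = 0 := by
    intro m
    induction m with
    | zero => intro i; simp [Z]
    | succ m ih => rw [hZ]; exact h0 _ ih
  have hZB : ∀ m i, wnorm r (Z m i) ≤ B i := by
    intro m
    induction m with
    | zero => intro i; simp [Z, wnorm_zero]
    | succ m ih => rw [hZ]; exact hB _ (hZ0 m) ih
  have hstep : ∀ m i α, w α < m → coeff α (Z (m + 1) i) = coeff α (Z m i) := by
    intro m
    induction m with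
    | zero => simp
    | succ m ih =>
      intro i α hα
      have := hΦ m (Z (m + 1)) (Z m) (hZ0 _) (hZ0 _) ih i α hα
      rwa [← hZ, ← hZ] at this
  have hstab : ∀ m k i α, w α < m → coeff α (Z (m + k) i) = coeff α (Z m i) := by
    intro m k i α hα
    induction k with
    | zero => rfl
    | succ k ih => rw [← ih, ← add_assoc, hstep _ _ _ (by omega)]
  -- The coefficient of `α` no longer changes after the iterate of index `w α + 1`.
  let Y : ι → MvPowerSeries σ ℂ := fun i α => coeff α (Z (w α + 1) i)
  have hY : ∀ m i α, w α < m → coeff α (Y i) = coeff α (Z m i) := by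
    intro m i α hα
    obtain ⟨k, rfl⟩ := Nat.exists_eq_add_of_le (Nat.succ_le_of_lt hα)
    exact (hstab _ _ _ _ (Nat.lt_succ_self _)).symm
  have hY0 : ∀ i, constantCoeff (Y i) = 0 := fun i => by
    rw [← coeff_zero_eq_constantCoeff_apply, hY _ i 0 (Nat.lt_succ_self _),
      coeff_zero_eq_constantCoeff_apply, hZ0]
  refine ⟨Y, hY0, ?_, fun i => ?_⟩
  · funext i
    ext α
    rw [hΦ (w α) Y (Z (w α)) hY0 (hZ0 _) (hY _) i α (Nat.lt_succ_self _), ← hZ,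
      hY _ i α (Nat.lt_succ_self _)]
  · unfold wnorm
    rw [ENNReal.tsum_eq_iSup_sum]
    refine iSup_le fun S => ?_
    refine le_trans (le_of_eq ?_) ((ENNReal.sum_le_tsum S).trans (hZB (S.sup w + 1) i))
    refine Finset.sum_congr rfl fun α hα => ?_
    rw [hY (S.sup w + 1) i α (Nat.lt_succ_of_le (Finset.le_sup hα))]

theorem fixedPoint_unique (w : (σ →₀ ℕ) → ℕ)
    (Φ : (ι → MvPowerSeries σ ℂ) → ι → MvPowerSeries σ ℂ)
    (hΦ : ∀ m Y Y', (∀ i, constantCoeff (Y i) = 0) → (∀ i, constantCoeff (Y' i) = 0) →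
      (∀ i α, w α < m → coeff α (Y i) = coeff α (Y' i)) →
      ∀ i α, w α < m + 1 → coeff α (Φ Y i) = coeff α (Φ Y' i))
    {Y Y' : ι → MvPowerSeries σ ℂ} (hY : ∀ i, constantCoeff (Y i) = 0)
    (hY' : ∀ i, constantCoeff (Y' i) = 0) (h : Φ Y = Y) (h' : Φ Y' = Y') : Y = Y' := by
  have key : ∀ m i α, w α < m → coeff α (Y i) = coeff α (Y' i) := by
    intro m
    induction m with
    | zero => simp
    | succ m ih =>
      have := hΦ m Y Y' hY hY' ih
      rwa [h, h'] at this
  funext i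
  ext α
  exact key _ i α (Nat.lt_succ_self _)

end fixedPoint

/-! ### The implicit function theorem -/

section implicit

variable {σ ι : Type*} [Fintype σ] [Fintype ι]

theorem exists_small_mul_le {κ : Type*} [Finite κ] {M : κ → ℝ≥0∞} (hM : ∀ j, M j < ⊤)
    {R : ℝ≥0} (hR : 0 < R) : ∃ t : ℝ≥0, 0 < t ∧ t ≤ 1 ∧ ∀ j, (t : ℝ≥0∞) * M j ≤ R := by
  have h1 : ∀ᶠ t : ℝ≥0 in 𝓝[>] 0, ∀ j, (t : ℝ≥0∞) * M j ≤ R := by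
    rw [eventually_all]
    intro j
    have h2 : Tendsto (fun t : ℝ≥0 => (t : ℝ≥0∞) * M j) (𝓝[>] 0) (𝓝 (0 * M j)) :=
      ENNReal.Tendsto.mul_const
        ((ENNReal.tendsto_coe.mpr tendsto_id).mono_left nhdsWithin_le_nhds) (Or.inr (hM j).ne)
    rw [zero_mul] at h2
    exact h2.eventually_le_const (by exact_mod_cast hR)
  have h3 : ∀ᶠ t : ℝ≥0 in 𝓝[>] 0, t ≤ 1 :=
    (eventually_le_nhds zero_lt_one).filter_mono nhdsWithin_le_nhds
  obtain ⟨t, ht, ht1, h⟩ := ((eventually_mem_nhdsWithin).and (h3.and h1)).exists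
  exact ⟨t, ht, ht1, h⟩

omit [Fintype σ] in
theorem coeff_mul_eq_zero_of_degree_lt {f g : MvPowerSeries σ ℂ} {m : ℕ}
    (hf : constantCoeff f = 0) (hg : ∀ α, α.degree < m → coeff α g = 0) :
    ∀ α, α.degree < m + 1 → coeff α (f * g) = 0 := by
  classical
  intro α hα
  rw [coeff_mul]
  refine Finset.sum_eq_zero fun p hp => ?_
  rw [Finset.HasAntidiagonal.mem_antidiagonal] at hp
  by_cases h : p.1 = 0
  · rw [h, coeff_zero_eq_constantCoeff_apply, hf, zero_mul]
  · rw [hg p.2, mul_zero]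
    have h1 : p.1.degree ≠ 0 := by rwa [ne_eq, Finsupp.degree_eq_zero_iff]
    have h2 : p.1.degree + p.2.degree = α.degree := by rw [← map_add, hp]
    omega

omit [Fintype σ] [Fintype ι] in
theorem constantCoeff_sumElim_X {Y : ι → MvPowerSeries σ ℂ} (hY : ∀ i, constantCoeff (Y i) = 0) :
    ∀ i, constantCoeff (Sum.elim X Y i : MvPowerSeries σ ℂ) = 0 := by
  rintro (i | i) <;> simp [hY]

/-- By Hadamard's lemma the difference is `∑ U_k (Y_k - Y'_k)` with `U_k(0) = ∂H_j/∂y_k(0) = 0`, so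
one degree of agreement is gained. -/
theorem implicit_contraction (H : ι → MvPowerSeries (σ ⊕ ι) ℂ)
    (h1 : ∀ j k, coeff (Finsupp.single (Sum.inr k) 1) (H j) = 0) (m : ℕ)
    (Y Y' : ι → MvPowerSeries σ ℂ) (hY : ∀ i, constantCoeff (Y i) = 0)
    (hY' : ∀ i, constantCoeff (Y' i) = 0)
    (h : ∀ i α, Finsupp.degree α < m → coeff α (Y i) = coeff α (Y' i)) :
    ∀ i α, Finsupp.degree α < m + 1 → coeff α (subst (Sum.elim X Y) (H i)) =
      coeff α (subst (Sum.elim X Y') (H i)) := by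
  intro j α hα
  obtain ⟨U, hU, hU0⟩ := exists_subst_sub_subst_eq (constantCoeff_sumElim_X hY)
    (constantCoeff_sumElim_X hY') (H j)
  rw [← sub_eq_zero, ← map_sub, hU, Fintype.sum_sum_type, map_add, map_sum, map_sum]
  simp only [Sum.elim_inl, sub_self, mul_zero, map_zero, Finset.sum_const_zero, zero_add,
    Sum.elim_inr]
  refine Finset.sum_eq_zero fun k _ => ?_
  refine coeff_mul_eq_zero_of_degree_lt (m := m) (by rw [hU0, h1]) (fun β hβ => ?_) α hα
  rw [map_sub, h k β hβ, sub_self]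

theorem implicit_unique (H : ι → MvPowerSeries (σ ⊕ ι) ℂ)
    (h1 : ∀ j k, coeff (Finsupp.single (Sum.inr k) 1) (H j) = 0)
    {Y Y' : ι → MvPowerSeries σ ℂ} (hY : ∀ i, constantCoeff (Y i) = 0)
    (hY' : ∀ i, constantCoeff (Y' i) = 0) (h : ∀ j, subst (Sum.elim X Y) (H j) = Y j)
    (h' : ∀ j, subst (Sum.elim X Y') (H j) = Y' j) : Y = Y' :=
  fixedPoint_unique Finsupp.degree (fun Y j => subst (Sum.elim X Y) (H j))
    (implicit_contraction H h1) hY hY' (funext h) (funext h')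

theorem exists_implicit (H : ι → MvPowerSeries (σ ⊕ ι) ℂ) (h0 : ∀ j, constantCoeff (H j) = 0)
    (h1 : ∀ j k, coeff (Finsupp.single (Sum.inr k) 1) (H j) = 0)
    (hc : ∀ j, IsConvergent (H j)) :
    ∃ Y : ι → MvPowerSeries σ ℂ, (∀ j, constantCoeff (Y j) = 0) ∧
      (∀ j, subst (Sum.elim X Y) (H j) = Y j) ∧ ∀ j, IsConvergent (Y j) := by
  classical
  obtain ⟨R, hR, hRM⟩ : ∃ R : ℝ≥0, 0 < R ∧ ∀ j, wnorm (fun _ => (R : ℝ≥0∞)) (H j) < ⊤ := by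
    have := eventually_all.mpr fun j => (hc j).eventually_wnorm_lt_top
    obtain ⟨R, hR, h⟩ := ((eventually_mem_nhdsWithin (a := (0 : ℝ≥0)) (s := Set.Ioi 0)).and
      (this.filter_mono nhdsWithin_le_nhds)).exists
    exact ⟨R, hR, h⟩
  obtain ⟨t, ht, ht1, htM⟩ := exists_small_mul_le hRM hR
  have ht1' : (t : ℝ≥0∞) ≤ 1 := by exact_mod_cast ht1
  -- With weight `2` for the parameters and `1` for the unknowns, the absence of a constant term and
  -- of terms linear in the unknowns says that every monomial of `H j` has weight at least `2`. At
  -- radii `t² R` and `t R` the norm of `H j` is then at most `t² M_j`, where `M_j` is its norm at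
  -- radius `R`, hence at most `t R` once `t M_j ≤ R`: the ball is preserved.
  let w : σ ⊕ ι → ℕ := Sum.elim (fun _ => 2) (fun _ => 1)
  have hw : ∀ j α, Finsupp.weight w α < 2 → coeff α (H j) = 0 := by
    intro j α hα
    have hdeg : α.degree ≤ Finsupp.weight w α := by
      rw [Finsupp.weight_apply, Finsupp.degree_apply, Finsupp.sum]
      refine Finset.sum_le_sum fun i _ => ?_
      have : 1 ≤ w i := by rcases i with i | i <;> simp [w]
      simpa using Nat.le_mul_of_pos_right (α i) this
    rcases Nat.lt_or_ge α.degree 1 with h | h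
    · have : α = 0 := by rwa [Nat.lt_one_iff, Finsupp.degree_eq_zero_iff] at h
      rw [this, coeff_zero_eq_constantCoeff_apply, h0]
    · have h2 : α.degree = 1 := by omega
      obtain ⟨i, rfl⟩ : ∃ i, α = Finsupp.single i 1 := by
        obtain ⟨i, hi⟩ : ∃ i, α i ≠ 0 := by
          by_contra! hc
          rw [show α = 0 from Finsupp.ext hc] at h2
          simp at h2
        have hle : Finsupp.single i 1 ≤ α := by
          simpa [Finsupp.single_le_iff, Nat.one_le_iff_ne_zero] using hi
        obtain ⟨β, rfl⟩ := exists_add_of_le hle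
        rw [map_add, Finsupp.degree_single, Nat.add_eq_left, Finsupp.degree_eq_zero_iff] at h2
        exact ⟨i, by rw [h2, add_zero]⟩
      rcases i with i | i
      · rw [Finsupp.weight_single] at hα
        simp [w] at hα
      · exact h1 j i
  obtain ⟨Y, hY0, hY, hYB⟩ := exists_fixedPoint Finsupp.degree
    (fun (Y : ι → MvPowerSeries σ ℂ) j => subst (Sum.elim X Y) (H j))
    (fun Y hY j => by
      rw [constantCoeff_subst_of_zero (constantCoeff_sumElim_X hY), h0])
    (implicit_contraction H h1) (fun _ => (t : ℝ≥0∞) ^ 2 * R) (fun _ => (t : ℝ≥0∞) ^ 1 * R)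
    (fun Y hY hB j => by
      calc _ ≤ _ := wnorm_subst_le
            (hasSubst_of_constantCoeff_zero (constantCoeff_sumElim_X hY)) (H j)
        _ ≤ wnorm (fun i => (t : ℝ≥0∞) ^ w i * R) (H j) := by
            refine wnorm_mono (fun i => ?_) _
            rcases i with i | i
            · simp [wnorm_X, w]
            · exact hB i
        _ ≤ (t : ℝ≥0∞) ^ 2 * wnorm (fun _ => (R : ℝ≥0∞)) (H j) :=
            wnorm_scale_le w 2 t ht1' (H j) (hw j)
        _ = (t : ℝ≥0∞) ^ 1 * (t * wnorm (fun _ => (R : ℝ≥0∞)) (H j)) := by ring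
        _ ≤ _ := by gcongr; exact htM j)
  refine ⟨Y, hY0, fun j => congrFun hY j, fun j => ?_⟩
  refine isConvergent_of_wnorm_lt_top (r := fun _ => (t : ℝ≥0∞) ^ 2 * R) (fun _ => ?_)
    ((hYB j).trans_lt ?_)
  · exact_mod_cast (by positivity : t ^ 2 * R ≠ 0)
  · exact ENNReal.mul_lt_top (by simp) (by simp)

end implicit

/-! ### Integration and differential equations -/

section ode

variable {σ : Type*}

/-- The primitive with respect to the variable `s` that vanishes for `s = 0`. -/
def primitive (s : σ) (f : MvPowerSeries σ ℂ) : MvPowerSeries σ ℂ :=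
  fun α => if α s = 0 then 0 else coeff (α - Finsupp.single s 1) f / α s

theorem coeff_primitive (s : σ) (f : MvPowerSeries σ ℂ) (α : σ →₀ ℕ) :
    coeff α (primitive s f) =
      if α s = 0 then 0 else coeff (α - Finsupp.single s 1) f / α s := rfl

theorem constantCoeff_primitive (s : σ) (f : MvPowerSeries σ ℂ) :
    constantCoeff (primitive s f) = 0 := by
  rw [← coeff_zero_eq_constantCoeff_apply, coeff_primitive]; simp

theorem pderiv_primitive (s : σ) (f : MvPowerSeries σ ℂ) : pderiv ℂ s (primitive s f) = f := by
  ext α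
  rw [coeff_pderiv, coeff_primitive, if_neg (by simp), add_tsub_cancel_right]
  simp only [Finsupp.add_apply, Finsupp.single_eq_same, Nat.cast_add, Nat.cast_one]
  exact div_mul_cancel₀ _ (by exact_mod_cast Nat.succ_ne_zero (α s))

theorem wnorm_primitive_le (r : σ → ℝ≥0∞) (s : σ) (f : MvPowerSeries σ ℂ) :
    wnorm r (primitive s f) ≤ r s * wnorm r f := by
  classical
  have h : wnorm r (primitive s f) ≤ wnorm r (X s * f) := by
    refine ENNReal.tsum_le_tsum fun α => ?_
    gcongr
    rw [coeff_primitive, coeff_X_mul']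
    split_ifs with h
    · rfl
    · rw [enorm_le_iff_norm_le, norm_div, Complex.norm_natCast]
      exact div_le_self (norm_nonneg _) (by exact_mod_cast Nat.one_le_iff_ne_zero.mpr h)
  refine h.trans ((wnorm_mul_le _ _).trans ?_)
  rw [wnorm_X]

theorem coeff_primitive_congr (s : σ) {f g : MvPowerSeries σ ℂ} {m : ℕ}
    (h : ∀ α : σ →₀ ℕ, α s < m → coeff α f = coeff α g) :
    ∀ α : σ →₀ ℕ, α s < m + 1 → coeff α (primitive s f) = coeff α (primitive s g) := by
  intro α hα
  rw [coeff_primitive, coeff_primitive]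
  split_ifs with h0
  · rfl
  · rw [h]
    simp only [Finsupp.tsub_apply, Finsupp.single_eq_same]
    omega

theorem isLowerSet_lt (s : σ) (m : ℕ) : IsLowerSet {α : σ →₀ ℕ | α s < m} :=
  fun _ _ hβα hα => (hβα s).trans_lt hα

/-- The equation expresses the coefficients of exponent `m` in `s` through those of smaller
exponent, division by `m` being harmless in characteristic zero. -/
theorem linear_ode_unique {ι : Type*} [Fintype ι] (s : σ) (A : ι → ι → MvPowerSeries σ ℂ)
    (F : ι → MvPowerSeries σ ℂ) (hF : ∀ j, pderiv ℂ s (F j) = ∑ k, A j k * F k)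
    (h0 : ∀ j (α : σ →₀ ℕ), α s = 0 → coeff α (F j) = 0) : F = 0 := by
  have key : ∀ m j (α : σ →₀ ℕ), α s < m → coeff α (F j) = 0 := by
    intro m
    induction m with
    | zero => simp
    | succ m ih =>
      intro j α hα
      by_cases h : α s = 0
      · exact h0 j α h
      have hle : Finsupp.single s 1 ≤ α := by
        simpa [Finsupp.single_le_iff, Nat.one_le_iff_ne_zero] using h
      have h1 := congrArg (coeff (α - Finsupp.single s 1)) (hF j)
      rw [coeff_pderiv, tsub_add_cancel_of_le hle, map_sum, Finset.sum_eq_zero] at h1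
      · refine (mul_eq_zero.mp h1).resolve_right ?_
        exact Nat.cast_add_one_ne_zero _
      · intro k _
        have h2 := coeff_mul_congr (isLowerSet_lt s m) (f := A j k) (fun _ _ => rfl)
          (g := F k) (g' := 0) (fun α hα => by rw [ih k α hα, map_zero])
          (α - Finsupp.single s 1) (by
            simp only [Set.mem_ofPred_eq, Finsupp.tsub_apply, Finsupp.single_eq_same]; omega)
        rw [h2, mul_zero, map_zero]
  funext j
  ext α
  exact key _ j α (Nat.lt_succ_self _)

/-- The matrix is `I + Y`, where `Y = ∫ (A + A Y) ds` is solved by iteration on the exponent of `s`.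
Only a formal solution is needed, whence the bound `⊤`. -/
theorem exists_fundamental_matrix {ι : Type*} [Fintype ι] [DecidableEq ι] (s : σ)
    (A : ι → ι → MvPowerSeries σ ℂ) : ∃ B : ι → ι → MvPowerSeries σ ℂ,
      (∀ j l, pderiv ℂ s (B j l) = ∑ k, A j k * B k l) ∧
      ∀ j l (α : σ →₀ ℕ), α s = 0 →
        coeff α (B j l) = coeff α (if j = l then 1 else 0 : MvPowerSeries σ ℂ) := by
  obtain ⟨Y, -, hY, -⟩ := exists_fixedPoint (fun α : σ →₀ ℕ => α s)
    (fun (Y : ι × ι → MvPowerSeries σ ℂ) p =>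
      primitive s (A p.1 p.2 + ∑ k, A p.1 k * Y (k, p.2)))
    (fun Y _ p => constantCoeff_primitive _ _)
    (fun m Y Y' _ _ h p => coeff_primitive_congr s fun α hα => by
      rw [map_add, map_add, map_sum, map_sum]
      congr 1
      exact Finset.sum_congr rfl fun k _ => coeff_mul_congr (isLowerSet_lt s m)
        (fun _ _ => rfl) (h _) α hα)
    0 (fun _ => ⊤) (fun _ _ _ _ => le_top)
  refine ⟨fun j l => (if j = l then 1 else 0) + Y (j, l), fun j l => ?_, fun j l α hα => ?_⟩
  · have h1 : pderiv ℂ s (if j = l then 1 else 0 : MvPowerSeries σ ℂ) = 0 := by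
      split_ifs
      · exact pderiv_one
      · exact map_zero _
    rw [map_add, h1, zero_add]
    conv_lhs => rw [← hY]
    rw [pderiv_primitive]
    simp only [mul_add, Finset.sum_add_distrib, mul_ite, mul_one, mul_zero,
      Finset.sum_ite_eq', Finset.mem_univ, if_true]
  · rw [map_add, ← hY, coeff_primitive, if_pos hα, add_zero]

/-- A solution of a linear system depends linearly on its initial value. -/
theorem exists_eq_sum_mul_of_linear_ode {ι : Type*} [Fintype ι] (s : σ)
    (A : ι → ι → MvPowerSeries σ ℂ) (F G : ι → MvPowerSeries σ ℂ)
    (hF : ∀ j, pderiv ℂ s (F j) = ∑ k, A j k * F k) (hG : ∀ j, pderiv ℂ s (G j) = 0)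
    (h0 : ∀ j (α : σ →₀ ℕ), α s = 0 → coeff α (F j) = coeff α (G j)) :
    ∃ B : ι → ι → MvPowerSeries σ ℂ, ∀ j, F j = ∑ k, B j k * G k := by
  classical
  obtain ⟨B, hB, hB0⟩ := exists_fundamental_matrix s A
  refine ⟨B, fun j => ?_⟩
  rw [← sub_eq_zero]
  -- Since `∂_s G = 0`, the difference `F - B G` solves the same system with zero initial value.
  refine congrFun (linear_ode_unique s A (fun j => F j - ∑ k, B j k * G k) (fun j => ?_)
    (fun j α hα => ?_)) j
  · simp only [map_sub, map_sum, Derivation.leibniz, hG, hB, hF, smul_eq_mul, mul_zero, zero_add,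
      mul_sub, Finset.sum_sub_distrib, Finset.mul_sum]
    rw [Finset.sum_comm]
    refine congrArg₂ _ rfl (Finset.sum_congr rfl fun k _ => Finset.sum_congr rfl fun l _ => ?_)
    ring
  · have hD : IsLowerSet {α : σ →₀ ℕ | α s = 0} :=
      fun _ _ hβα hα => Nat.le_zero.mp ((hβα s).trans (le_of_eq hα))
    rw [map_sub, map_sum, h0 j α hα, sub_eq_zero]
    have : ∀ k, coeff α (B j k * G k) =
        coeff α ((if j = k then 1 else 0 : MvPowerSeries σ ℂ) * G k) :=
      fun k => coeff_mul_congr hD (hB0 j k) (fun _ _ => rfl) α hα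
    simp_rw [this, ite_mul, one_mul, zero_mul, ← map_sum]
    simp

end ode

/-- Existence of the local holomorphic flow. -/
theorem exists_isLocalFlow {n : ℕ} (a : Fin n → MvPowerSeries (Fin n) ℂ)
    (ha : ∀ i, IsConvergent (a i)) :
    ∃ φ : Fin n → MvPowerSeries (Option (Fin n)) ℂ, IsLocalFlow a φ := by
  classical
  obtain ⟨R, hR, hRM⟩ : ∃ R : ℝ≥0, 0 < R ∧ ∀ j, wnorm (fun _ => (R : ℝ≥0∞)) (a j) < ⊤ := by
    have := eventually_all.mpr fun j => (ha j).eventually_wnorm_lt_top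
    obtain ⟨R, hR, h⟩ := ((eventually_mem_nhdsWithin (a := (0 : ℝ≥0)) (s := Set.Ioi 0)).and
      (this.filter_mono nhdsWithin_le_nhds)).exists
    exact ⟨R, hR, h⟩
  -- Here `t` is the radius in time and `R / 2` the radius in space: the Picard map `Y ↦ t_i + ∫
  -- a_i(Y) ds` has norm at most `R / 2 + t M_i ≤ R`, with `M_i` the norm of `a i` at radius `R`.
  obtain ⟨t, ht, -, htM⟩ := exists_small_mul_le hRM (half_pos hR)
  let r : Option (Fin n) → ℝ≥0∞ := fun o => o.elim (t : ℝ≥0∞) fun _ => ((R / 2 : ℝ≥0) : ℝ≥0∞)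
  obtain ⟨φ, hφ0, hφ, hφB⟩ := exists_fixedPoint (fun α : Option (Fin n) →₀ ℕ => α none)
    (fun (Y : Fin n → MvPowerSeries (Option (Fin n)) ℂ) i =>
      X (some i) + primitive none (subst Y (a i)))
    (fun Y _ i => by rw [map_add, constantCoeff_primitive, constantCoeff_X, add_zero])
    (fun m Y Y' hY hY' h i α hα => by
      rw [map_add, map_add]
      congr 1
      exact coeff_primitive_congr none (coeff_subst_congr (isLowerSet_lt _ m)
        (hasSubst_of_constantCoeff_zero hY) (hasSubst_of_constantCoeff_zero hY') h (a i)) α hα)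
    r (fun _ => R) (fun Y hY hB i => by
      calc _ ≤ wnorm r (X (some i)) + wnorm r (primitive none (subst Y (a i))) :=
            wnorm_add_le _ _
        _ ≤ ((R / 2 : ℝ≥0) : ℝ≥0∞) + t * wnorm r (subst Y (a i)) := by
            rw [wnorm_X]
            gcongr
            · rfl
            · exact wnorm_primitive_le r none _
        _ ≤ ((R / 2 : ℝ≥0) : ℝ≥0∞) + t * wnorm (fun _ => (R : ℝ≥0∞)) (a i) := by
            gcongr
            exact (wnorm_subst_le (hasSubst_of_constantCoeff_zero hY) _).trans (wnorm_mono hB _)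
        _ ≤ ((R / 2 : ℝ≥0) : ℝ≥0∞) + ((R / 2 : ℝ≥0) : ℝ≥0∞) := by gcongr; exact htM i
        _ = R := by rw [← ENNReal.coe_add, add_halves])
  refine ⟨φ, fun i => ?_, fun i => ?_, fun i => ?_⟩
  · refine isConvergent_of_wnorm_lt_top (r := r) (fun o => ?_) ((hφB i).trans_lt (by simp))
    rcases o with _ | o
    · simpa [r] using ht.ne'
    · simpa [r] using hR.ne'
  · have hk : ∀ o : Option (Fin n), constantCoeff
        (o.elim (0 : MvPowerSeries (Fin n) ℂ) X) = 0 := by rintro (_ | o) <;> simp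
    have hk' := hasSubst_of_constantCoeff_zero hk
    rw [← congrFun hφ i]
    obtain ⟨q, h1⟩ : X none ∣ primitive none (subst φ (a i)) :=
      X_dvd_iff.mpr fun α hα => by rw [coeff_primitive, if_pos hα]
    rw [h1, subst_add hk', subst_mul hk', subst_X hk', subst_X hk']
    simp
  · conv_lhs => rw [← congrFun hφ i]
    rw [map_add, pderiv_primitive, pderiv_X_of_ne (by simp), zero_add]

/-! ### Values of convergent power series -/

section evalAt

variable {σ τ : Type*} {x : σ → ℂ}

theorem enorm_term_eq (f : MvPowerSeries σ ℂ) (x : σ → ℂ) (α : σ →₀ ℕ) :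
    ‖coeff α f * α.prod (fun i k => x i ^ k)‖ₑ =
      ‖coeff α f‖ₑ * α.prod (fun i k => ‖x i‖ₑ ^ k) := by
  rw [enorm_mul]
  simp only [Finsupp.prod, enorm_eq_nnnorm, nnnorm_prod, nnnorm_pow,
    ENNReal.ofNNReal_finsetProd, ENNReal.coe_pow]

theorem tsum_enorm_term (f : MvPowerSeries σ ℂ) (x : σ → ℂ) :
    ∑' α : σ →₀ ℕ, ‖coeff α f * α.prod (fun i k => x i ^ k)‖ₑ = wnorm (fun i => ‖x i‖ₑ) f :=
  tsum_congr fun α => enorm_term_eq f x α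

theorem summable_term {f : MvPowerSeries σ ℂ} (hf : wnorm (fun i => ‖x i‖ₑ) f < ⊤) :
    Summable fun α : σ →₀ ℕ => ‖coeff α f * α.prod (fun i k => x i ^ k)‖ := by
  rw [← tsum_enorm_term] at hf
  have := ENNReal.summable_toReal hf.ne
  simpa only [toReal_enorm] using this

theorem enorm_evalAt_le (f : MvPowerSeries σ ℂ) (x : σ → ℂ) :
    ‖evalAt f x‖ₑ ≤ wnorm (fun i => ‖x i‖ₑ) f := by
  rw [← tsum_enorm_term]
  exact enorm_tsum_le_tsum_enorm

theorem evalAt_monomial (α : σ →₀ ℕ) (c : ℂ) (x : σ → ℂ) :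
    evalAt (monomial α c) x = c * α.prod (fun i k => x i ^ k) := by
  classical
  unfold evalAt
  rw [tsum_eq_single α, coeff_monomial_same]
  intro β hβ
  rw [coeff_monomial_ne hβ, zero_mul]

theorem evalAt_C (c : ℂ) (x : σ → ℂ) : evalAt (C c) x = c := by
  rw [← monomial_zero_eq_C_apply, evalAt_monomial]; simp

theorem evalAt_one (x : σ → ℂ) : evalAt 1 x = 1 := by
  rw [← map_one C, evalAt_C]

theorem evalAt_zero (x : σ → ℂ) : evalAt 0 x = 0 := by
  rw [← map_zero C, evalAt_C]

theorem evalAt_X (i : σ) (x : σ → ℂ) : evalAt (X i) x = x i := by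
  rw [X_def, evalAt_monomial]; simp

theorem evalAt_add {f g : MvPowerSeries σ ℂ} (hf : wnorm (fun i => ‖x i‖ₑ) f < ⊤)
    (hg : wnorm (fun i => ‖x i‖ₑ) g < ⊤) : evalAt (f + g) x = evalAt f x + evalAt g x := by
  unfold evalAt
  rw [← (summable_term hf).of_norm.tsum_add (summable_term hg).of_norm]
  exact tsum_congr fun α => by rw [map_add, add_mul]

theorem evalAt_sum {ι : Type*} (s : Finset ι) {f : ι → MvPowerSeries σ ℂ}
    (hf : ∀ j ∈ s, wnorm (fun i => ‖x i‖ₑ) (f j) < ⊤) :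
    evalAt (∑ j ∈ s, f j) x = ∑ j ∈ s, evalAt (f j) x := by
  classical
  unfold evalAt
  rw [← Summable.tsum_finsetSum fun j hj => (summable_term (hf j hj)).of_norm]
  exact tsum_congr fun α => by rw [map_sum, Finset.sum_mul]

theorem evalAt_mul {f g : MvPowerSeries σ ℂ} (hf : wnorm (fun i => ‖x i‖ₑ) f < ⊤)
    (hg : wnorm (fun i => ‖x i‖ₑ) g < ⊤) : evalAt (f * g) x = evalAt f x * evalAt g x := by
  classical
  have h := summable_mul_of_summable_norm
    (f := fun α : σ →₀ ℕ => coeff α f * α.prod (fun i k => x i ^ k))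
    (g := fun α : σ →₀ ℕ => coeff α g * α.prod (fun i k => x i ^ k))
    (summable_term hf) (summable_term hg)
  refine Eq.trans ?_ ((summable_term hf).of_norm.tsum_mul_tsum_eq_tsum_sum_antidiagonal
    (summable_term hg).of_norm h).symm
  refine tsum_congr fun α => ?_
  rw [coeff_mul, Finset.sum_mul]
  refine Finset.sum_congr rfl fun p hp => ?_
  rw [← Finset.HasAntidiagonal.mem_antidiagonal.mp hp, Finsupp.prod_add_index' (by simp)
    (by intros; rw [pow_add])]
  ring

theorem evalAt_pow {f : MvPowerSeries σ ℂ} (hf : wnorm (fun i => ‖x i‖ₑ) f < ⊤) (k : ℕ) :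
    evalAt (f ^ k) x = evalAt f x ^ k := by
  induction k with
  | zero => simp [evalAt_one]
  | succ k ih =>
    rw [pow_succ, pow_succ, evalAt_mul _ hf, ih]
    exact (wnorm_pow_le _ _).trans_lt (ENNReal.pow_lt_top hf)

theorem evalAt_prod {ι : Type*} (s : Finset ι) {f : ι → MvPowerSeries σ ℂ}
    (hf : ∀ j, wnorm (fun i => ‖x i‖ₑ) (f j) < ⊤) :
    evalAt (∏ j ∈ s, f j) x = ∏ j ∈ s, evalAt (f j) x := by
  classical
  induction s using Finset.induction_on with
  | empty => simp [evalAt_one]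
  | insert a s ha ih =>
    rw [Finset.prod_insert ha, Finset.prod_insert ha, evalAt_mul (hf a), ih]
    exact (wnorm_prod_le _ _).trans_lt (ENNReal.prod_lt_top fun j _ => hf j)

theorem evalAt_finsuppProd {g : τ → MvPowerSeries σ ℂ}
    (hg : ∀ j, wnorm (fun i => ‖x i‖ₑ) (g j) < ⊤) (d : τ →₀ ℕ) :
    evalAt (d.prod fun i k => g i ^ k) x = d.prod fun i k => evalAt (g i) x ^ k := by
  unfold Finsupp.prod
  rw [evalAt_prod _ fun j => (wnorm_pow_le _ _).trans_lt (ENNReal.pow_lt_top (hg j))]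
  exact Finset.prod_congr rfl fun j _ => evalAt_pow (hg j) _

theorem evalAt_subst {g : τ → MvPowerSeries σ ℂ} (hs : HasSubst g)
    (hg : ∀ j, wnorm (fun i => ‖x i‖ₑ) (g j) < ⊤) {f : MvPowerSeries τ ℂ}
    (hf : wnorm (fun j => wnorm (fun i => ‖x i‖ₑ) (g j)) f < ⊤) :
    evalAt (subst g f) x = evalAt f fun j => evalAt (g j) x := by
  -- The double family behind the composition; finiteness of the iterated norm makes it absolutely
  -- summable, so both orders of summation agree.
  let T : (σ →₀ ℕ) × (τ →₀ ℕ) → ℂ := fun p =>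
    coeff p.2 f * (coeff p.1 (p.2.prod fun i k => g i ^ k) * p.1.prod fun i k => x i ^ k)
  have hT : Summable T := by
    refine Summable.of_norm ?_
    have h1 : ∑' p, ‖T p‖ₑ < ⊤ := by
      refine lt_of_le_of_lt ?_ hf
      rw [ENNReal.tsum_prod', ENNReal.tsum_comm]
      refine ENNReal.tsum_le_tsum fun d => ?_
      simp only [T, enorm_mul (coeff d f)]
      rw [ENNReal.tsum_mul_left, tsum_enorm_term]
      gcongr
      exact wnorm_finsuppProd_le g d
    simpa only [toReal_enorm] using ENNReal.summable_toReal h1.ne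
  have h1 : evalAt (subst g f) x = ∑' e : σ →₀ ℕ, ∑' d : τ →₀ ℕ, T (e, d) := by
    unfold evalAt
    refine tsum_congr fun e => ?_
    rw [coeff_subst_eq_tsum hs, ← tsum_mul_right]
    exact tsum_congr fun d => mul_assoc _ _ _
  have h2 : ∑' e : σ →₀ ℕ, ∑' d : τ →₀ ℕ, T (e, d) = ∑' d : τ →₀ ℕ, ∑' e : σ →₀ ℕ, T (e, d) :=
    (Summable.tsum_comm (f := fun e d => T (e, d)) hT).symm
  have h3 : ∀ d : τ →₀ ℕ, ∑' e : σ →₀ ℕ, T (e, d) =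
      coeff d f * d.prod fun i k => evalAt (g i) x ^ k := fun d => by
    rw [← evalAt_finsuppProd hg d]
    unfold evalAt
    rw [← tsum_mul_left]
  rw [h1, h2]
  exact tsum_congr h3

theorem evalAt_conjSeries (f : MvPowerSeries σ ℂ) (x : σ → ℂ) :
    evalAt (conjSeries f) (fun i => starRingEnd ℂ (x i)) = starRingEnd ℂ (evalAt f x) := by
  unfold evalAt conjSeries
  rw [Complex.conj_tsum]
  refine tsum_congr fun α => ?_
  simp [Finsupp.prod]

theorem eventually_of_antitone_nnnorm [Fintype σ] {p : ℝ≥0 → Prop} (h : ∀ᶠ r in 𝓝 0, p r) :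
    ∀ᶠ x : σ → ℂ in 𝓝 0, p ‖x‖₊ := by
  have : Tendsto (fun x : σ → ℂ => ‖x‖₊) (𝓝 0) (𝓝 0) := by
    simpa using (continuous_nnnorm (E := σ → ℂ)).tendsto 0
  exact this.eventually h

theorem wnorm_enorm_le [Fintype σ] (f : MvPowerSeries σ ℂ) (x : σ → ℂ) :
    wnorm (fun i => ‖x i‖ₑ) f ≤ wnorm (fun _ => (‖x‖₊ : ℝ≥0∞)) f :=
  wnorm_mono (fun i => by
    rw [enorm_eq_nnnorm]; exact_mod_cast nnnorm_le_pi_nnnorm x i) f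

theorem IsConvergent.eventually_lt_top [Fintype σ] {f : MvPowerSeries σ ℂ}
    (hf : IsConvergent f) : ∀ᶠ x : σ → ℂ in 𝓝 0, wnorm (fun i => ‖x i‖ₑ) f < ⊤ := by
  filter_upwards [eventually_of_antitone_nnnorm (σ := σ) hf.eventually_wnorm_lt_top] with x hx
  exact (wnorm_enorm_le f x).trans_lt hx

theorem IsConvergent.eventually_le [Fintype σ] {f : MvPowerSeries σ ℂ}
    (hf : IsConvergent f) (h0 : constantCoeff f = 0) {ε : ℝ≥0∞} (hε : ε ≠ 0) :
    ∀ᶠ x : σ → ℂ in 𝓝 0, wnorm (fun i => ‖x i‖ₑ) f ≤ ε := by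
  filter_upwards [eventually_of_antitone_nnnorm (σ := σ) (hf.eventually_wnorm_le h0 hε)] with x hx
  exact (wnorm_enorm_le f x).trans hx

theorem IsConvergent.tendsto_evalAt [Fintype σ] {f : MvPowerSeries σ ℂ}
    (hf : IsConvergent f) (h0 : constantCoeff f = 0) : Tendsto (evalAt f) (𝓝 0) (𝓝 0) := by
  rw [tendsto_zero_iff_enorm_tendsto_zero, ENNReal.tendsto_nhds_zero]
  intro ε hε
  filter_upwards [hf.eventually_le h0 hε.ne'] with x hx
  exact (enorm_evalAt_le f x).trans hx

theorem IsConvergent.eventually_evalAt_subst [Fintype σ] [Finite τ] {f : MvPowerSeries τ ℂ}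
    (hf : IsConvergent f) {g : τ → MvPowerSeries σ ℂ} (hg : ∀ i, IsConvergent (g i))
    (hg0 : ∀ i, constantCoeff (g i) = 0) :
    ∀ᶠ x : σ → ℂ in 𝓝 0, evalAt (MvPowerSeries.subst g f) x =
      evalAt f fun j => evalAt (g j) x := by
  obtain ⟨R, hR, h⟩ := hf.exists_wnorm_lt_top
  have := eventually_all.mpr fun i => (hg i).eventually_le (hg0 i)
    (ε := (R : ℝ≥0∞)) (by simpa using hR.ne')
  filter_upwards [this] with x hx
  exact evalAt_subst (hasSubst_of_constantCoeff_zero hg0)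
    (fun j => (hx j).trans_lt (by simp)) ((wnorm_mono hx f).trans_lt h)

end evalAt

/-! ### The identity theorem -/

section identity

variable {σ τ : Type*}

theorem evalAt_coe (P : MvPolynomial σ ℂ) (x : σ → ℂ) :
    evalAt (P : MvPowerSeries σ ℂ) x = MvPolynomial.eval x P := by
  unfold evalAt
  rw [tsum_eq_sum (s := P.support), MvPolynomial.eval_eq]
  · simp only [MvPolynomial.coeff_coe, Finsupp.prod]
  · intro α hα
    rw [MvPolynomial.coeff_coe, MvPolynomial.notMem_support_iff.mp hα, zero_mul]

theorem aeval_mul_of_isHomogeneous {A : Type*} [CommRing A] [Algebra ℂ A] {P : MvPolynomial σ ℂ}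
    {m : ℕ} (hP : P.IsHomogeneous m) (s : A) (y : σ → A) :
    MvPolynomial.aeval (fun i => s * y i) P = s ^ m * MvPolynomial.aeval y P := by
  rw [MvPolynomial.aeval_def, MvPolynomial.aeval_def, MvPolynomial.eval₂_eq,
    MvPolynomial.eval₂_eq, Finset.mul_sum]
  refine Finset.sum_congr rfl fun α hα => ?_
  have h1 : α.degree = m := by
    rw [Finsupp.degree_eq_weight_one]
    exact hP (MvPolynomial.mem_support_iff.mp hα)
  simp only [mul_pow, Finset.prod_mul_distrib, Finset.prod_pow_eq_pow_sum]
  rw [← Finsupp.degree_apply, h1]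
  ring

/-- The leading form of a nonzero power series. -/
theorem exists_leading_form [Finite σ] {f : MvPowerSeries σ ℂ} (hf : f ≠ 0) :
    ∃ (m : ℕ) (P : MvPolynomial σ ℂ), P.IsHomogeneous m ∧ P ≠ 0 ∧
      ∀ α : σ →₀ ℕ, α.degree < m + 1 → coeff α f = coeff α (P : MvPowerSeries σ ℂ) := by
  classical
  have hex : ∃ m, ∃ α : σ →₀ ℕ, α.degree = m ∧ coeff α f ≠ 0 := by
    obtain ⟨α, hα⟩ := (ne_zero_iff_exists_coeff_ne_zero f).mp hf
    exact ⟨_, α, rfl, hα⟩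
  obtain ⟨α, hαm, hα⟩ := Nat.find_spec hex
  set m := Nat.find hex with hm
  have hmin : ∀ β : σ →₀ ℕ, β.degree < m → coeff β f = 0 := by
    intro β hβ
    by_contra h
    exact Nat.find_min hex hβ ⟨β, rfl, h⟩
  refine ⟨m, truncTotal (m + 1) f, ?_, ?_, ?_⟩
  · intro β hβ
    rw [coeff_truncTotal_eq_ite] at hβ
    split_ifs at hβ with h
    · change Finsupp.weight (fun _ => 1) β = m
      rw [← Finsupp.degree_eq_weight_one]
      refine le_antisymm (Nat.lt_succ_iff.mp h) ?_
      by_contra hlt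
      exact hβ (hmin β (not_le.mp hlt))
    · exact absurd rfl hβ
  · intro h
    have := congrArg (MvPolynomial.coeff α) h
    rw [coeff_truncTotal _ (by omega)] at this
    exact hα this
  · intro β hβ
    rw [MvPolynomial.coeff_coe, coeff_truncTotal _ hβ]

/-- Along the ray `t z` the leading form contributes `t^m P(z)` and the remainder `O(t^(m+1))`.
Vanishing of `f` thus forces `P(z) = 0` for all `z` in a small real cube, which is too large for a
nonzero polynomial. -/
theorem eq_zero_of_evalAt_real [Fintype σ] {f : MvPowerSeries σ ℂ} (hf : IsConvergent f)
    (h : ∀ᶠ x : σ → ℝ in 𝓝 0, evalAt f (fun i => (x i : ℂ)) = 0) : f = 0 := by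
  by_contra hne
  obtain ⟨m, P, hPm, hP0, hP⟩ := exists_leading_form hne
  obtain ⟨R, hR, hfR⟩ := hf.exists_wnorm_lt_top
  obtain ⟨ε, hε, hεf⟩ := Metric.eventually_nhds_iff.mp h
  set δ : ℝ := min ε R with hδ
  have hδ0 : 0 < δ := lt_min hε hR
  refine hP0 (MvPolynomial.funext_set (fun _ => (fun y : ℝ => (y : ℂ)) '' Set.Ioo 0 δ)
    (fun _ => (Set.Ioo_infinite hδ0).image Complex.ofReal_injective.injOn) fun z hz => ?_)
  rw [map_zero]
  choose y hy hyz using fun i => hz i (Set.mem_univ i)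
  set g := f - (P : MvPowerSeries σ ℂ) with hg
  have hPf : ∀ α, ‖coeff α (P : MvPowerSeries σ ℂ)‖ₑ ≤ ‖coeff α f‖ₑ := by
    intro α
    by_cases hα : α.degree < m + 1
    · rw [hP α hα]
    · rw [MvPolynomial.coeff_coe, hPm.coeff_eq_zero (d := α) (by omega)]; simp
  have hPR : wnorm (fun _ => (R : ℝ≥0∞)) (P : MvPowerSeries σ ℂ) < ⊤ :=
    (ENNReal.tsum_le_tsum fun α => by gcongr; exact hPf α).trans_lt hfR
  have hgR : wnorm (fun _ => (R : ℝ≥0∞)) g < ⊤ :=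
    (wnorm_sub_le _ _).trans_lt (ENNReal.add_lt_top.mpr ⟨hfR, hPR⟩)
  set M := (wnorm (fun _ => (R : ℝ≥0∞)) g).toReal with hM
  -- The choice of `δ` keeps `t z` both in the neighbourhood where `f` vanishes and in the polydisc
  -- of radius `R` where the norms are finite.
  have key : ∀ t : ℝ≥0, 0 < t → t ≤ 1 → ‖MvPolynomial.eval z P‖ ≤ t * M := by
    intro t ht ht1
    have hx : ∀ i, ‖(t : ℂ) * z i‖ₑ ≤ (t : ℝ≥0∞) ^ (1 : ℕ) * R := by
      intro i
      rw [enorm_mul, pow_one]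
      gcongr
      · simp [enorm_eq_nnnorm]
      · rw [← hyz i, enorm_le_coe, ← NNReal.coe_le_coe, coe_nnnorm, Complex.norm_real,
          Real.norm_of_nonneg (hy i).1.le]
        exact ((hy i).2.trans_le (min_le_right _ _)).le
    have hxR : ∀ i, ‖(t : ℂ) * z i‖ₑ ≤ R := fun i => (hx i).trans (by
      rw [pow_one]; exact mul_le_of_le_one_left' (by exact_mod_cast ht1))
    have h0 : evalAt f (fun i => (t : ℂ) * z i) = 0 := by
      have := hεf (y := fun i => t * y i) (by
        rw [dist_pi_lt_iff hε]
        intro i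
        rw [Pi.zero_apply, dist_zero_right, norm_mul, Real.norm_of_nonneg (hy i).1.le]
        have h1 : ‖(t : ℝ)‖ ≤ 1 := by simpa using ht1
        calc ‖(t : ℝ)‖ * y i ≤ 1 * y i := by gcongr; exact (hy i).1.le
          _ < ε := by rw [one_mul]; exact (hy i).2.trans_le (min_le_left _ _))
      rw [← this]
      congr 1
      funext i
      rw [← hyz i]
      push_cast
      rfl
    have h1 : evalAt f (fun i => (t : ℂ) * z i) =
        (t : ℂ) ^ m * MvPolynomial.eval z P + evalAt g (fun i => (t : ℂ) * z i) := by
      have h2 := aeval_mul_of_isHomogeneous hPm (t : ℂ) z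
      simp only [MvPolynomial.aeval_eq_eval] at h2
      rw [← h2, ← evalAt_coe, ← evalAt_add]
      · rw [hg, add_sub_cancel]
      · exact (wnorm_mono hxR _).trans_lt hPR
      · exact (wnorm_mono hxR _).trans_lt hgR
    have h3 : ‖(t : ℂ) ^ m * MvPolynomial.eval z P‖ₑ ≤
        (t : ℝ≥0∞) ^ (m + 1) * wnorm (fun _ => (R : ℝ≥0∞)) g := by
      rw [h0] at h1
      rw [eq_neg_of_add_eq_zero_left h1.symm, enorm_neg]
      refine (enorm_evalAt_le _ _).trans ((wnorm_mono hx g).trans ?_)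
      refine wnorm_scale_le (fun _ => 1) (m + 1) t (by exact_mod_cast ht1) g fun α hα => ?_
      rw [← Finsupp.degree_eq_weight_one] at hα
      rw [hg, map_sub, hP α hα, sub_self]
    have h4 := ENNReal.toReal_mono (ENNReal.mul_lt_top (by simp) hgR).ne h3
    rw [toReal_enorm, norm_mul, norm_pow, ENNReal.toReal_mul, ENNReal.toReal_pow,
      ENNReal.coe_toReal, ← hM] at h4
    have h5 : ‖(t : ℂ)‖ = t := by simp
    rw [h5, pow_succ, mul_assoc] at h4
    exact le_of_mul_le_mul_left h4 (by positivity)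
  rw [← norm_le_zero_iff]
  have hlim : Tendsto (fun t : ℝ≥0 => (t : ℝ) * M) (𝓝[>] 0) (𝓝 0) := by
    have h6 : Tendsto (fun t : ℝ≥0 => (t : ℝ) * M) (𝓝 0) (𝓝 (((0 : ℝ≥0) : ℝ) * M)) :=
      (NNReal.continuous_coe.tendsto 0).mul_const M
    simpa using h6.mono_left nhdsWithin_le_nhds
  refine ge_of_tendsto hlim ?_
  filter_upwards [eventually_mem_nhdsWithin, (eventually_le_nhds (zero_lt_one (α := ℝ≥0))).filter_mono
    nhdsWithin_le_nhds] with t ht ht1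
  exact key t ht ht1

/-- The set of points `(p, p̄)` is maximally totally real: the invertible linear change `t = x + i
y`, `t̄ = x - i y` carries real points `(x, y)` to it, which reduces the claim to real arguments. -/
theorem eq_zero_of_evalAt_withConj {n : ℕ} {f : CRSeries n} (hf : IsConvergent f)
    (h : ∀ᶠ p : Fin n → ℂ in 𝓝 0, evalAt f (withConj p) = 0) : f = 0 := by
  let L : Fin n ⊕ Fin n → CRSeries n := Sum.elim
    (fun i => X (Sum.inl i) + C Complex.I * X (Sum.inr i))
    (fun i => X (Sum.inl i) - C Complex.I * X (Sum.inr i))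
  let L' : Fin n ⊕ Fin n → CRSeries n := Sum.elim
    (fun i => C (1 / 2) * (X (Sum.inl i) + X (Sum.inr i)))
    (fun i => C (-Complex.I / 2) * (X (Sum.inl i) - X (Sum.inr i)))
  have hL0 : ∀ i, constantCoeff (L i) = 0 := by rintro (i | i) <;> simp [L]
  have hL0' : ∀ i, constantCoeff (L' i) = 0 := by rintro (i | i) <;> simp [L']
  have hLc : ∀ i, IsConvergent (L i) := by
    rintro (i | i)
    · exact (isConvergent_X _).add ((isConvergent_C _).mul (isConvergent_X _))
    · exact (isConvergent_X _).sub ((isConvergent_C _).mul (isConvergent_X _))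
  have hLs := hasSubst_of_constantCoeff_zero hL0
  have hLs' := hasSubst_of_constantCoeff_zero hL0'
  have hinv : subst L' (subst L f) = f := by
    rw [subst_comp_subst_apply hLs hLs']
    have : (fun i => subst L' (L i)) = X := by
      funext i
      rcases i with i | i
      · simp only [L, Sum.elim_inl, ← coe_substAlgHom hLs', map_add, map_mul, substAlgHom_X]
        simp only [coe_substAlgHom, subst_C, L', Sum.elim_inl, Sum.elim_inr]
        have h1 : C Complex.I * C (-Complex.I / 2) = (C (1 / 2) : CRSeries n) := by
          rw [← map_mul]; congr 1
          linear_combination (-1 / 2) * Complex.I_mul_I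
        have h2 : C (1 / 2) + C (1 / 2) = (1 : CRSeries n) := by
          rw [← map_add, add_halves, map_one]
        linear_combination (X (Sum.inl i) - X (Sum.inr i)) * h1 + X (Sum.inl i) * h2
      · simp only [L, Sum.elim_inr, ← coe_substAlgHom hLs', map_sub, map_mul, substAlgHom_X]
        simp only [coe_substAlgHom, subst_C, L', Sum.elim_inl, Sum.elim_inr]
        have h1 : C Complex.I * C (-Complex.I / 2) = (C (1 / 2) : CRSeries n) := by
          rw [← map_mul]; congr 1
          linear_combination (-1 / 2) * Complex.I_mul_I
        have h2 : C (1 / 2) + C (1 / 2) = (1 : CRSeries n) := by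
          rw [← map_add, add_halves, map_one]
        linear_combination -(X (Sum.inl i) - X (Sum.inr i)) * h1 + X (Sum.inr i) * h2
    rw [this, subst_self, id]
  rw [← hinv]
  suffices subst L f = 0 by
    rw [this, ← coe_substAlgHom hLs', map_zero]
  refine eq_zero_of_evalAt_real (hf.subst hLc hL0) ?_
  have hcoe : Tendsto (fun (x : Fin n ⊕ Fin n → ℝ) i => (x i : ℂ)) (𝓝 0) (𝓝 0) := by
    have : Continuous (fun (x : Fin n ⊕ Fin n → ℝ) i => (x i : ℂ)) := by fun_prop
    simpa [Pi.zero_def] using this.tendsto 0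
  have hp : Tendsto (fun (x : Fin n ⊕ Fin n → ℝ) i =>
      (x (Sum.inl i) + Complex.I * x (Sum.inr i) : ℂ)) (𝓝 0) (𝓝 0) := by
    have : Continuous (fun (x : Fin n ⊕ Fin n → ℝ) (i : Fin n) =>
      (x (Sum.inl i) + Complex.I * x (Sum.inr i) : ℂ)) := by fun_prop
    simpa [Pi.zero_def] using this.tendsto 0
  filter_upwards [hcoe.eventually (hf.eventually_evalAt_subst hLc hL0), hp.eventually h]
    with x hx hpx
  rw [hx, ← hpx]
  congr 1
  have hfin : ∀ (y : Fin n ⊕ Fin n → ℂ) (c : ℂ) j,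
      wnorm (fun i => ‖y i‖ₑ) (C c * X j : CRSeries n) < ⊤ := fun y c j =>
    (wnorm_mul_le _ _).trans_lt (by rw [wnorm_C, wnorm_X]; exact ENNReal.mul_lt_top (by simp) (by simp))
  have hval : ∀ (c : ℂ) j (y : Fin n ⊕ Fin n → ℂ), evalAt (C c * X j : CRSeries n) y = c * y j :=
    fun c j y => by
      rw [evalAt_mul (by simp [wnorm_C]) (by simp [wnorm_X]), evalAt_C, evalAt_X]
  funext i
  rcases i with i | i
  · simp only [L, Sum.elim_inl, withConj]
    rw [evalAt_add (by simp [wnorm_X]) (hfin _ _ _), hval, evalAt_X]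
  · simp only [L, Sum.elim_inr, withConj]
    rw [sub_eq_add_neg, ← neg_mul, ← map_neg, evalAt_add (by simp [wnorm_X]) (hfin _ _ _), hval,
      evalAt_X]
    simp

end identity

/-! ### Retractions onto the zero set of power series with independent differentials -/

section retraction

variable {σ κ : Type*} [Fintype σ] [Fintype κ]

/-- The map `x ↦ x + V Y(x)`. -/
def shiftMap (V : σ → κ → ℂ) (Y : κ → MvPowerSeries σ ℂ) (a : σ) : MvPowerSeries σ ℂ :=
  X a + ∑ j, C (V a j) * Y j

omit [Fintype σ] in
theorem constantCoeff_shiftMap (V : σ → κ → ℂ) {Y : κ → MvPowerSeries σ ℂ}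
    (hY : ∀ j, constantCoeff (Y j) = 0) (a : σ) : constantCoeff (shiftMap V Y a) = 0 := by
  simp [shiftMap, hY]

theorem isConvergent_shiftMap (V : σ → κ → ℂ) {Y : κ → MvPowerSeries σ ℂ}
    (hY : ∀ j, IsConvergent (Y j)) (a : σ) : IsConvergent (shiftMap V Y a) :=
  (isConvergent_X a).add (IsConvergent.sum _ fun j _ => (isConvergent_C _).mul (hY j))

variable [DecidableEq κ]

/-- The equation `R(x + V y) = 0` written as a fixed point equation for `y`. -/
def retractionEq (V : σ → κ → ℂ) (R : κ → MvPowerSeries σ ℂ) (j : κ) :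
    MvPowerSeries (σ ⊕ κ) ℂ :=
  X (Sum.inr j) - subst (fun a => X (Sum.inl a) + ∑ k, C (V a k) * X (Sum.inr k)) (R j)

omit [DecidableEq κ] in
theorem subst_retractionEq (V : σ → κ → ℂ) (R : κ → MvPowerSeries σ ℂ) (j : κ)
    {Y : κ → MvPowerSeries σ ℂ} (hY : ∀ j, constantCoeff (Y j) = 0) :
    subst (Sum.elim X Y) (retractionEq V R j) = Y j - subst (shiftMap V Y) (R j) := by
  have h1 : ∀ a : σ, constantCoeff
      (X (Sum.inl a) + ∑ k, C (V a k) * X (Sum.inr k) : MvPowerSeries (σ ⊕ κ) ℂ) = 0 := by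
    intro a; simp
  have hs := hasSubst_of_constantCoeff_zero (constantCoeff_sumElim_X hY)
  rw [retractionEq, subst_sub hs, subst_X hs,
    subst_comp_subst_apply (hasSubst_of_constantCoeff_zero h1) hs]
  congr 2
  funext a
  simp only [← coe_substAlgHom hs, map_add, map_sum, map_mul, substAlgHom_X]
  simp only [coe_substAlgHom, subst_C, shiftMap, Sum.elim_inl, Sum.elim_inr]

/-- The columns of `V` are dual to the differentials of `R` at `0`, so the linear part of `R(x + V
y)` in `y` is `y` itself and cancels. -/
theorem coeff_retractionEq (V : σ → κ → ℂ) (R : κ → MvPowerSeries σ ℂ)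
    (hV : ∀ j k, ∑ a, coeff (Finsupp.single a 1) (R j) * V a k = if j = k then 1 else 0) (j k : κ) :
    coeff (Finsupp.single (Sum.inr k) 1) (retractionEq V R j) = 0 := by
  classical
  have h1 : ∀ a : σ, constantCoeff
      (X (Sum.inl a) + ∑ k, C (V a k) * X (Sum.inr k) : MvPowerSeries (σ ⊕ κ) ℂ) = 0 := by
    intro a; simp
  rw [retractionEq, map_sub, coeff_single_subst h1, sub_eq_zero]
  have h2 : ∀ a : σ, coeff (Finsupp.single (Sum.inr k) 1)
      (X (Sum.inl a) + ∑ k, C (V a k) * X (Sum.inr k) : MvPowerSeries (σ ⊕ κ) ℂ) = V a k := by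
    intro a
    simp [coeff_C_mul, coeff_X, Finsupp.single_left_inj]
  simp_rw [h2, hV, coeff_X, Finsupp.single_left_inj one_ne_zero, Sum.inr.injEq, eq_comm]

theorem exists_retraction (V : σ → κ → ℂ) (R : κ → MvPowerSeries σ ℂ)
    (hR0 : ∀ j, constantCoeff (R j) = 0) (hR : ∀ j, IsConvergent (R j))
    (hV : ∀ j k, ∑ a, coeff (Finsupp.single a 1) (R j) * V a k = if j = k then 1 else 0) :
    ∃ Y : κ → MvPowerSeries σ ℂ, (∀ j, constantCoeff (Y j) = 0) ∧ (∀ j, IsConvergent (Y j)) ∧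
      ∀ j, subst (shiftMap V Y) (R j) = 0 := by
  have h1 : ∀ a : σ, constantCoeff
      (X (Sum.inl a) + ∑ k, C (V a k) * X (Sum.inr k) : MvPowerSeries (σ ⊕ κ) ℂ) = 0 := by
    intro a; simp
  obtain ⟨Y, hY0, hY, hYc⟩ := exists_implicit (retractionEq V R)
    (fun j => by rw [retractionEq, map_sub, constantCoeff_subst_of_zero h1, hR0]; simp)
    (coeff_retractionEq V R hV)
    (fun j => (isConvergent_X _).sub ((hR j).subst (fun a => (isConvergent_X _).add
      (IsConvergent.sum _ fun k _ => (isConvergent_C _).mul (isConvergent_X _))) h1))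
  refine ⟨Y, hY0, hYc, fun j => ?_⟩
  have := hY j
  rwa [subst_retractionEq V R j hY0, sub_eq_self] at this

theorem retraction_unique (V : σ → κ → ℂ) (R : κ → MvPowerSeries σ ℂ)
    (hV : ∀ j k, ∑ a, coeff (Finsupp.single a 1) (R j) * V a k = if j = k then 1 else 0)
    {Y Y' : κ → MvPowerSeries σ ℂ} (hY0 : ∀ j, constantCoeff (Y j) = 0)
    (hY0' : ∀ j, constantCoeff (Y' j) = 0) (hY : ∀ j, subst (shiftMap V Y) (R j) = 0)
    (hY' : ∀ j, subst (shiftMap V Y') (R j) = 0) : Y = Y' :=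
  implicit_unique (retractionEq V R) (coeff_retractionEq V R hV) hY0 hY0'
    (fun j => by rw [subst_retractionEq V R j hY0, hY, sub_zero])
    (fun j => by rw [subst_retractionEq V R j hY0', hY', sub_zero])

/-- A power series vanishing on the zero set of `R` is a combination of the `R j`. -/
theorem exists_eq_sum_mul_of_subst_eq_zero (V : σ → κ → ℂ) (R : κ → MvPowerSeries σ ℂ)
    (hV : ∀ j k, ∑ a, coeff (Finsupp.single a 1) (R j) * V a k = if j = k then 1 else 0)
    {Y : κ → MvPowerSeries σ ℂ} (hY0 : ∀ j, constantCoeff (Y j) = 0)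
    (hY : ∀ j, subst (shiftMap V Y) (R j) = 0) {G : MvPowerSeries σ ℂ}
    (hG : subst (shiftMap V Y) G = 0) : ∃ c : κ → MvPowerSeries σ ℂ, G = ∑ k, c k * R k := by
  -- If `f` vanishes after the retraction, then `f(x) = f(x) - f(x + V Y)`, and Hadamard's lemma
  -- puts `f` in the ideal of the `Y_j`.
  have key : ∀ f : MvPowerSeries σ ℂ, subst (shiftMap V Y) f = 0 →
      ∃ W : κ → MvPowerSeries σ ℂ, f = ∑ j, W j * Y j ∧
        ∀ j, constantCoeff (W j) = -∑ a, coeff (Finsupp.single a 1) f * V a j := by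
    intro f hf
    obtain ⟨U, hU, hU0⟩ := exists_subst_sub_subst_eq (g := X) (g' := shiftMap V Y)
      (fun i => constantCoeff_X i) (constantCoeff_shiftMap V hY0) f
    rw [subst_self, id, hf, sub_zero] at hU
    refine ⟨fun j => -∑ a, U a * C (V a j), ?_, fun j => ?_⟩
    · conv_lhs => rw [hU]
      simp only [shiftMap, sub_add_cancel_left, mul_neg, Finset.mul_sum, neg_mul, Finset.sum_mul,
        Finset.sum_neg_distrib]
      rw [Finset.sum_comm]
      simp only [mul_assoc]
    · simp [hU0]
  choose W hW hW0 using fun j => key (R j) (hY j)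
  -- For `f = R j` the coefficient matrix is `-1` at the origin, so the `R_j` and the `Y_j` generate
  -- the same ideal.
  have hdet : IsUnit (Matrix.of W).det := by
    rw [MvPowerSeries.isUnit_iff_constantCoeff, RingHom.map_det]
    have : (constantCoeff (σ := σ) (R := ℂ)).mapMatrix (Matrix.of W) = -1 := by
      ext j k
      simp only [RingHom.mapMatrix_apply, Matrix.map_apply, Matrix.of_apply, hW0, hV,
        Matrix.neg_apply, Matrix.one_apply]
    rw [this, Matrix.det_neg, Matrix.det_one, mul_one]
    exact (isUnit_one.neg).pow _
  have hWY : Matrix.mulVec (Matrix.of W) Y = R := by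
    funext j
    rw [hW j]
    rfl
  have hinv : Y = Matrix.mulVec (Matrix.of W)⁻¹ R := by
    rw [← hWY, Matrix.mulVec_mulVec, Matrix.nonsing_inv_mul _ hdet, Matrix.one_mulVec]
  obtain ⟨Z, hZ, -⟩ := key G hG
  refine ⟨Matrix.vecMul Z (Matrix.of W)⁻¹, ?_⟩
  have : G = dotProduct Z (Matrix.mulVec (Matrix.of W)⁻¹ R) := by
    rw [← hinv]; exact hZ
  rw [this, Matrix.dotProduct_mulVec]
  rfl

end retraction

/-! ### Tangent vector fields preserve the ideal of the defining functions -/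

section tangent

variable {n d : ℕ}

/-- The involution `f(t, t̄) ↦ f̄(t̄, t)`. -/
def crConj (f : CRSeries n) : CRSeries n := rename Sum.swap (conjSeries f)

theorem crConj_eq_subst (f : CRSeries n) :
    crConj f = subst (fun a => X (Sum.swap a) : _ → CRSeries n) (conjSeries f) :=
  rename_eq_subst _ _

theorem hasSubst_X_swap : HasSubst (fun a => X (Sum.swap a) : Fin n ⊕ Fin n → CRSeries n) :=
  hasSubst_of_constantCoeff_zero fun a => by simp

theorem crConj_subst (f : CRSeries n) {g : Fin n ⊕ Fin n → CRSeries n}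
    (hg : ∀ a, constantCoeff (g a) = 0) :
    crConj (subst g f) = subst (fun a => crConj (g (Sum.swap a))) (crConj f) := by
  have hgs := hasSubst_of_constantCoeff_zero hg
  have hg' : ∀ a, constantCoeff (crConj (g (Sum.swap a))) = 0 := fun a => by
    rw [crConj, constantCoeff_rename, conjSeries, constantCoeff_map, hg, map_zero]
  have hgs' := hasSubst_of_constantCoeff_zero hg'
  rw [crConj_eq_subst f, subst_comp_subst_apply hasSubst_X_swap hgs']
  rw [crConj_eq_subst, conjSeries, map_subst hgs,
    subst_comp_subst_apply (hgs.map _) hasSubst_X_swap]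
  congr 1
  funext a
  rw [subst_X hgs', Sum.swap_swap, crConj_eq_subst]
  rfl

theorem coeff_single_crConj (f : CRSeries n) (a : Fin n ⊕ Fin n) :
    coeff (Finsupp.single a 1) (crConj f) =
      starRingEnd ℂ (coeff (Finsupp.single (Sum.swap a) 1) f) := by
  classical
  rw [crConj_eq_subst, coeff_single_subst (fun a => by simp), Finset.sum_eq_single (Sum.swap a)]
  · simp [conjSeries, coeff_X]
  · intro b _ hb
    rw [coeff_X, if_neg, mul_zero]
    rw [Finsupp.single_left_inj one_ne_zero]
    rintro rfl
    exact hb (Sum.swap_swap b).symm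
  · simp

theorem tendsto_withConj : Tendsto (withConj (n := n)) (𝓝 0) (𝓝 0) := by
  have h : Continuous (withConj (n := n)) := by
    refine continuous_pi fun a => ?_
    rcases a with i | i
    · exact continuous_apply i
    · exact Complex.continuous_conj.comp (continuous_apply i)
  have h0 : withConj (0 : Fin n → ℂ) = 0 := by
    funext a
    rcases a with i | i <;> simp [withConj]
  simpa [h0] using h.tendsto 0

theorem IsConvergent.eventually_evalAt_rename {σ τ : Type*} [Fintype σ] [Finite τ]
    {f : MvPowerSeries τ ℂ} (hf : IsConvergent f) (e : τ → σ) [TendstoCofinite e] :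
    ∀ᶠ x : σ → ℂ in 𝓝 0, evalAt (MvPowerSeries.rename e f) x = evalAt f fun i => x (e i) := by
  rw [rename_eq_subst]
  filter_upwards [hf.eventually_evalAt_subst (g := X ∘ e) (fun i => isConvergent_X (e i))
    (fun i => by simp)] with x hx
  rw [hx]
  congr 1
  funext i
  exact evalAt_X _ _

theorem eventually_evalAt_crConj {f : CRSeries n} (hf : IsConvergent f) :
    ∀ᶠ p : Fin n → ℂ in 𝓝 0,
      evalAt (crConj f) (withConj p) = starRingEnd ℂ (evalAt f (withConj p)) := by
  filter_upwards [tendsto_withConj.eventually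
    (hf.conjSeries.eventually_evalAt_rename Sum.swap)] with p hp
  rw [crConj, hp, ← evalAt_conjSeries]
  congr 1
  funext a
  rcases a with i | i <;> simp [withConj]

/-- The value `1 / 2` is chosen because the direction used later is `(v, v̄)`: the `t` and `t̄`
parts of the differential of a real `ρ_k` each contribute one half, and the direction is compatible
with conjugation. -/
theorem exists_dual_vectors {ρ : Fin d → CRSeries n} (hρ : IsGenericDefining ρ) :
    ∃ v : Fin d → Fin n → ℂ, ∀ k j, ∑ i, coeff (Finsupp.single (Sum.inl i) 1) (ρ k) * v j i =
      if k = j then 1 / 2 else 0 := by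
  let D : Fin d → Fin n → ℂ := fun k i => constantCoeff (pderiv ℂ (Sum.inl i) (ρ k))
  have hD : LinearIndependent ℂ D := hρ.generic
  obtain ⟨g, hg⟩ := (Fintype.linearCombination ℂ D).exists_leftInverse_of_injective (by
    rw [LinearMap.ker_eq_bot]
    exact hD.fintypeLinearCombination_injective)
  have hgD : ∀ k, g (D k) = Pi.single k 1 := fun k => by
    have := LinearMap.congr_fun hg (Pi.single k 1)
    simpa [Fintype.linearCombination_apply_single] using this
  refine ⟨fun j i => g (Pi.single i 1) j / 2, fun k j => ?_⟩
  have h1 : D k = ∑ i, D k i • (Pi.single i 1 : Fin n → ℂ) := by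
    conv_lhs => rw [pi_eq_sum_univ' (D k)]
  have h2 := congrFun (hgD k) j
  rw [h1, map_sum, Finset.sum_apply] at h2
  simp only [map_smul, Pi.smul_apply, smul_eq_mul] at h2
  calc _ = (∑ i, D k i * g (Pi.single i 1) j) / 2 := by
        rw [Finset.sum_div]
        refine Finset.sum_congr rfl fun i _ => ?_
        rw [coeff_single_eq_constantCoeff_pderiv, mul_div_assoc]
    _ = _ := by
        rw [h2, Pi.single_apply]
        simp only [eq_comm]
        split_ifs <;> simp

/-- Tangency is a condition at points of `M` only; the retraction `θ` turns it into an identity of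
series. Since `θ` is real, it sends `(p, p̄)` to some `(q, q̄)` with `q` in `M`, so `G ∘ θ` vanishes
at all `(p, p̄)` near `0` and therefore identically. -/
theorem exists_eq_sum_mul_of_isTangent {ρ : Fin d → CRSeries n} (hρ : IsGenericDefining ρ)
    {a : Fin n → MvPowerSeries (Fin n) ℂ} (ha : ∀ i, IsConvergent (a i)) (hT : IsTangent a ρ)
    (j : Fin d) : ∃ c : Fin d → CRSeries n,
      ∑ i, rename Sum.inl (a i) * pderiv ℂ (Sum.inl i) (ρ j) = ∑ k, c k * ρ k := by
  classical
  obtain ⟨v, hv⟩ := exists_dual_vectors hρ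
  have hreal : ∀ j, crConj (ρ j) = ρ j := fun j => (hρ.real j).symm
  let V : Fin n ⊕ Fin n → Fin d → ℂ :=
    Sum.elim (fun i k => v k i) (fun i k => starRingEnd ℂ (v k i))
  have hVswap : ∀ b k, V (Sum.swap b) k = starRingEnd ℂ (V b k) := by
    rintro (i | i) k <;> simp [V]
  have hV : ∀ j k, ∑ b, coeff (Finsupp.single b 1) (ρ j) * V b k = if j = k then 1 else 0 := by
    intro j k
    have h1 : ∀ i, coeff (Finsupp.single (Sum.inr i) 1) (ρ j) =
        starRingEnd ℂ (coeff (Finsupp.single (Sum.inl i) 1) (ρ j)) := fun i => by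
      conv_lhs => rw [← hreal j]
      rw [coeff_single_crConj, Sum.swap_inr]
    rw [Fintype.sum_sum_type]
    simp only [h1, V, Sum.elim_inl, Sum.elim_inr, ← map_mul, ← map_sum, hv]
    split_ifs
    · rw [map_div₀, map_one, Complex.conj_ofNat, add_halves]
    · simp
  obtain ⟨Y, hY0, hYc, hY⟩ := exists_retraction V ρ hρ.zero hρ.convergent hV
  set θ := shiftMap V Y with hθ
  have hθ0 : ∀ b, constantCoeff (θ b) = 0 := constantCoeff_shiftMap V hY0
  have hθc : ∀ b, IsConvergent (θ b) := isConvergent_shiftMap V hYc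
  -- Both `ρ` and `V` are invariant under the involution, so `crConj (Y k)` solves the same
  -- equations and uniqueness applies.
  have hYreal : ∀ k, crConj (Y k) = Y k := by
    have h0 : ∀ k, constantCoeff (crConj (Y k)) = 0 := fun k => by
      rw [crConj, constantCoeff_rename, conjSeries, constantCoeff_map, hY0, map_zero]
    refine congrFun (retraction_unique V ρ hV h0 hY0 (fun k => ?_) hY)
    have h1 := crConj_subst (ρ k) hθ0
    rw [hY, hreal] at h1
    have h2 : (fun b => crConj (θ (Sum.swap b))) = shiftMap V fun k => crConj (Y k) := by
      funext b
      simp [hθ, shiftMap, crConj, conjSeries, hVswap]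
    rw [← h2, ← h1]
    simp [crConj, conjSeries]
  let q : (Fin n → ℂ) → Fin n → ℂ := fun p i => evalAt (θ (Sum.inl i)) (withConj p)
  have hq : Tendsto q (𝓝 0) (𝓝 0) := by
    refine tendsto_pi_nhds.mpr fun i => ?_
    exact ((hθc _).tendsto_evalAt (hθ0 _)).comp tendsto_withConj
  have hqθ : ∀ᶠ p in 𝓝 0, ∀ b, evalAt (θ b) (withConj p) = withConj (q p) b := by
    have h1 := eventually_all.mpr fun k => eventually_evalAt_crConj (hYc k)
    have h2 := tendsto_withConj.eventually
      (eventually_all.mpr fun k => (hYc k).eventually_lt_top)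
    filter_upwards [h1, h2] with p hp hp2
    have hval : ∀ b, evalAt (θ b) (withConj p) =
        withConj p b + ∑ k, V b k * evalAt (Y k) (withConj p) := by
      intro b
      have h3 : ∀ k, wnorm (fun i => ‖withConj p i‖ₑ) (C (V b k) * Y k) < ⊤ := fun k =>
        (wnorm_mul_le _ _).trans_lt (ENNReal.mul_lt_top (by simp [wnorm_C]) (hp2 k))
      rw [hθ, shiftMap, evalAt_add (by simp [wnorm_X]), evalAt_X, evalAt_sum _ fun k _ => h3 k]
      · congr 1
        exact Finset.sum_congr rfl fun k _ => by
          rw [evalAt_mul (by simp [wnorm_C]) (hp2 k), evalAt_C]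
      · have h4 : ∀ s : Finset (Fin d), wnorm (fun i => ‖withConj p i‖ₑ)
            (∑ k ∈ s, C (V b k) * Y k) < ⊤ := by
          intro s
          induction s using Finset.induction_on with
          | empty => simp [wnorm_zero]
          | insert k s hk ih =>
            rw [Finset.sum_insert hk]
            exact (wnorm_add_le _ _).trans_lt (ENNReal.add_lt_top.mpr ⟨h3 k, ih⟩)
        exact h4 _
    rintro (i | i)
    · rfl
    · have h5 : ∀ k, starRingEnd ℂ (evalAt (Y k) (withConj p)) = evalAt (Y k) (withConj p) :=
        fun k => by rw [← hp k, hYreal]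
      change _ = starRingEnd ℂ (evalAt (θ (Sum.inl i)) (withConj p))
      rw [hval, hval]
      rw [map_add, map_sum]
      simp only [map_mul, h5]
      rfl
  set G := ∑ i, rename Sum.inl (a i) * pderiv ℂ (Sum.inl i) (ρ j) with hG
  have hac : ∀ i, IsConvergent (rename Sum.inl (a i) : CRSeries n) := fun i => (ha i).rename _
  have hGc : IsConvergent G :=
    IsConvergent.sum _ fun i _ => (hac i).mul ((hρ.convergent j).pderiv _)
  refine exists_eq_sum_mul_of_subst_eq_zero V ρ hV hY0 hY
    (eq_zero_of_evalAt_withConj (hGc.subst hθc hθ0) ?_)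
  have hGval : ∀ᶠ p : Fin n → ℂ in 𝓝 0, evalAt G (withConj p) =
      ∑ i, evalAt (a i) p * evalAt (pderiv ℂ (Sum.inl i) (ρ j)) (withConj p) := by
    filter_upwards [tendsto_withConj.eventually
        (eventually_all.mpr fun i => (ha i).eventually_evalAt_rename
          (Sum.inl : Fin n → Fin n ⊕ Fin n)),
      tendsto_withConj.eventually (eventually_all.mpr fun i => (hac i).eventually_lt_top),
      tendsto_withConj.eventually (eventually_all.mpr fun i =>
        ((hρ.convergent j).pderiv (Sum.inl i)).eventually_lt_top)] with p h1 h2 h3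
    rw [hG, evalAt_sum _ fun i _ => (wnorm_mul_le _ _).trans_lt
      (ENNReal.mul_lt_top (h2 i) (h3 i))]
    exact Finset.sum_congr rfl fun i _ => by
      rw [evalAt_mul (h2 i) (h3 i), h1 i]
      rfl
  filter_upwards [hqθ, hq.eventually hT, hq.eventually hGval,
    tendsto_withConj.eventually (hGc.eventually_evalAt_subst hθc hθ0),
    tendsto_withConj.eventually (eventually_all.mpr fun k =>
      (hρ.convergent k).eventually_evalAt_subst hθc hθ0)] with p h1 h2 h3 h4 h5
  have h6 : (fun b => evalAt (θ b) (withConj p)) = withConj (q p) := funext h1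
  rw [h4, h6, h3]
  refine h2 (fun k => ?_) j
  rw [← h6, ← h5, hY, evalAt_zero]

end tangent

/-! ### Flows of tangent fields yield formal CR maps -/

section rename

variable {σ τ υ : Type*}

theorem subst_rename [Finite τ] (e : σ → τ) [TendstoCofinite e] {g : τ → MvPowerSeries υ ℂ}
    (hg : ∀ i, constantCoeff (g i) = 0) (f : MvPowerSeries σ ℂ) :
    subst g (rename e f) = subst (fun i => g (e i)) f := by
  have hgs := hasSubst_of_constantCoeff_zero hg
  rw [rename_eq_subst, subst_comp_subst_apply (HasSubst.X_comp e) hgs]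
  congr 1
  funext i
  exact subst_X hgs _

theorem rename_subst [Finite σ] (e : τ → υ) [TendstoCofinite e] {g : σ → MvPowerSeries τ ℂ}
    (hg : ∀ i, constantCoeff (g i) = 0) (f : MvPowerSeries σ ℂ) :
    rename e (subst g f) = subst (fun i => rename e (g i)) f := by
  rw [rename_eq_subst, subst_comp_subst_apply (hasSubst_of_constantCoeff_zero hg)
    (HasSubst.X_comp e)]
  congr 1
  funext i
  exact (rename_eq_subst e _).symm

theorem pderiv_rename [Finite σ] (e : σ → τ) [TendstoCofinite e] (he : Function.Injective e) (i : σ)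
    (f : MvPowerSeries σ ℂ) : pderiv ℂ (e i) (rename e f) = rename e (pderiv ℂ i f) := by
  classical
  have := Fintype.ofFinite σ
  rw [rename_eq_subst, pderiv_subst (fun i => by simp), Finset.sum_eq_single i]
  · rw [Function.comp_apply, pderiv_X_self, mul_one, rename_eq_subst]
  · intro j _ hj
    rw [Function.comp_apply, pderiv_X_of_ne (he.ne hj), mul_zero]
  · simp

theorem pderiv_rename_of_notMem [Finite σ] (e : σ → τ) [TendstoCofinite e] {j : τ} (hj : ∀ i, e i ≠ j)
    (f : MvPowerSeries σ ℂ) : pderiv ℂ j (rename e f) = 0 := by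
  have := Fintype.ofFinite σ
  rw [rename_eq_subst, pderiv_subst (fun i => by simp)]
  exact Finset.sum_eq_zero fun i _ => by
    rw [Function.comp_apply, pderiv_X_of_ne (hj i), mul_zero]

end rename

section flow

variable {n d : ℕ}

theorem constantCoeff_elim {ϖ : MvPowerSeries (Fin n) ℂ} (h : constantCoeff ϖ = 0) :
    ∀ o : Option (Fin n), constantCoeff (o.elim ϖ X : MvPowerSeries (Fin n) ℂ) = 0 := by
  rintro (_ | i) <;> simp [h]

/-- Setting `s = 0` leaves the coefficients with no `s` unchanged, so `φ(0, t) = t` means that `s`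
divides `φ_i - t_i`. -/
theorem IsLocalFlow.exists_eq {a : Fin n → MvPowerSeries (Fin n) ℂ}
    {φ : Fin n → MvPowerSeries (Option (Fin n)) ℂ} (hφ : IsLocalFlow a φ) (i : Fin n) :
    ∃ q, φ i = X (some i) + X none * q := by
  classical
  let κ : Option (Fin n) → MvPowerSeries (Option (Fin n)) ℂ := fun o =>
    rename some (o.elim (0 : MvPowerSeries (Fin n) ℂ) X)
  have h0 := constantCoeff_elim (n := n) (map_zero constantCoeff)
  have hκ : ∀ o, constantCoeff (κ o) = 0 := fun o => by rw [constantCoeff_rename, h0]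
  obtain ⟨q, hq⟩ : X none ∣ φ i - X (some i) := by
    refine X_dvd_iff.mpr fun α hα => ?_
    have h1 := congrArg (rename some) (hφ.initial i)
    rw [rename_subst _ h0, rename_X] at h1
    rw [map_sub, sub_eq_zero, ← h1]
    conv_lhs => rw [show φ i = subst X (φ i) by rw [subst_self, id]]
    refine coeff_subst_congr (D := {α | α none = 0}) (fun β γ hγ hβ => Nat.le_zero.mp
      ((hγ none).trans (le_of_eq hβ))) HasSubst.X (hasSubst_of_constantCoeff_zero hκ)
      (fun o β hβ => ?_) (φ i) α hα
    rcases o with _ | k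
    · have : β ≠ Finsupp.single none 1 := by rintro rfl; simp at hβ
      simp [coeff_X, this, κ]
    · simp [κ, rename_X]
  exact ⟨q, by rw [← hq]; ring⟩

theorem IsLocalFlow.constantCoeff_eq_zero {a : Fin n → MvPowerSeries (Fin n) ℂ}
    {φ : Fin n → MvPowerSeries (Option (Fin n)) ℂ} (hφ : IsLocalFlow a φ) (i : Fin n) :
    constantCoeff (φ i) = 0 := by
  obtain ⟨q, hq⟩ := hφ.exists_eq i
  simp [hq]

/-- Only `t` is moved by the flow while `t̄` stays a free parameter. By the chain rule the left side
has `s`-derivative `(X ρ_j)(φ, t̄) = ∑ c_jk(φ, t̄) ρ_k(φ, t̄)`, a linear system with initial value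
`ρ`. -/
theorem exists_subst_flow_eq {ρ : Fin d → CRSeries n} (hρ : IsGenericDefining ρ)
    {a : Fin n → MvPowerSeries (Fin n) ℂ} (ha : ∀ i, IsConvergent (a i)) (hT : IsTangent a ρ)
    {φ : Fin n → MvPowerSeries (Option (Fin n)) ℂ} (hφ : IsLocalFlow a φ) :
    ∃ B : Fin d → Fin d → MvPowerSeries (Option (Fin n) ⊕ Fin n) ℂ, ∀ j,
      subst (Sum.elim (fun i => rename Sum.inl (φ i)) (fun i => X (Sum.inr i)) :
        Fin n ⊕ Fin n → MvPowerSeries (Option (Fin n) ⊕ Fin n) ℂ) (ρ j) =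
      ∑ k, B j k * rename (Sum.map some id) (ρ k) := by
  classical
  choose c hc using exists_eq_sum_mul_of_isTangent hρ ha hT
  set η : Fin n ⊕ Fin n → MvPowerSeries (Option (Fin n) ⊕ Fin n) ℂ :=
    Sum.elim (fun i => rename Sum.inl (φ i)) (fun i => X (Sum.inr i)) with hη
  have hφ0 := hφ.constantCoeff_eq_zero
  have hη0 : ∀ b, constantCoeff (η b) = 0 := by rintro (i | i) <;> simp [η, hφ0]
  have hηs := hasSubst_of_constantCoeff_zero hη0
  refine exists_eq_sum_mul_of_linear_ode (Sum.inl none) (fun j k => subst η (c j k)) _ _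
    (fun j => ?_) (fun j => ?_) (fun j α hα => ?_)
  · have h1 := congrArg (subst η) (hc j)
    simp only [← coe_substAlgHom hηs, map_sum, map_mul] at h1
    simp only [coe_substAlgHom] at h1
    rw [← h1, pderiv_subst hη0, Fintype.sum_sum_type]
    have h2 : ∀ i : Fin n, pderiv ℂ (Sum.inl none) (η (Sum.inr i)) = 0 := fun i =>
      pderiv_X_of_ne (by simp)
    simp only [h2, mul_zero, Finset.sum_const_zero, add_zero]
    refine Finset.sum_congr rfl fun i _ => ?_
    rw [subst_rename _ hη0, mul_comm]
    congr 1
    change pderiv ℂ (Sum.inl none) (rename Sum.inl (φ i)) = _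
    rw [pderiv_rename _ Sum.inl_injective, hφ.ode, rename_subst _ hφ0]
    rfl
  · refine pderiv_rename_of_notMem _ ?_ _
    rintro (i | i) <;> simp
  · rw [rename_eq_subst]
    refine coeff_subst_congr (D := {α | α (Sum.inl none) = 0}) (fun β γ hγ hβ => Nat.le_zero.mp
      ((hγ (Sum.inl none)).trans (le_of_eq hβ))) hηs (HasSubst.X_comp _)
      (fun b β hβ => ?_) (ρ j) α hα
    rcases b with i | i
    · obtain ⟨q, hq⟩ := hφ.exists_eq i
      simp only [hη, Sum.elim_inl, hq, map_add, map_mul, rename_X, Function.comp_apply,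
        Sum.map_inl]
      rw [coeff_X_mul', if_pos (show β (Sum.inl none) = 0 from hβ), add_zero]
    · rfl

theorem isFormalCRMap_substTime {ρ : Fin d → CRSeries n} (hρ : IsGenericDefining ρ)
    {a : Fin n → MvPowerSeries (Fin n) ℂ} (ha : ∀ i, IsConvergent (a i)) (hT : IsTangent a ρ)
    {φ : Fin n → MvPowerSeries (Option (Fin n)) ℂ} (hφ : IsLocalFlow a φ)
    {ϖ : MvPowerSeries (Fin n) ℂ} (hϖ : constantCoeff ϖ = 0) :
    IsFormalCRMap ρ ρ fun k => substTime ϖ (φ k) := by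
  have hφ0 := hφ.constantCoeff_eq_zero
  have hel := constantCoeff_elim hϖ
  set h : Fin n → MvPowerSeries (Fin n) ℂ := fun k => substTime ϖ (φ k) with hh
  have hh0 : ∀ k, constantCoeff (h k) = 0 := fun k => by
    change constantCoeff (subst _ (φ k)) = 0
    rw [constantCoeff_subst_of_zero hel, hφ0]
  have hh0' : ∀ k, constantCoeff (conjSeries (h k)) = 0 := fun k => by
    rw [conjSeries, constantCoeff_map, hh0, map_zero]
  have hreal : ∀ j, crConj (ρ j) = ρ j := fun j => (hρ.real j).symm
  refine ⟨hh0, ?_⟩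
  obtain ⟨B, hB⟩ := exists_subst_flow_eq hρ ha hT hφ
  let ψ : Option (Fin n) ⊕ Fin n → CRSeries n :=
    Sum.elim (fun o => rename Sum.inl (o.elim ϖ X)) (fun i => X (Sum.inr i))
  have hψ0 : ∀ b, constantCoeff (ψ b) = 0 := by
    rintro (o | i)
    · simp [ψ, constantCoeff_rename, hel]
    · simp [ψ]
  have hψs := hasSubst_of_constantCoeff_zero hψ0
  let g : Fin n ⊕ Fin n → CRSeries n :=
    Sum.elim (fun i => rename Sum.inl (h i)) (fun i => X (Sum.inr i))
  have hg0 : ∀ b, constantCoeff (g b) = 0 := by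
    rintro (i | i)
    · simp [g, constantCoeff_rename, hh0]
    · simp [g]
  have hgs := hasSubst_of_constantCoeff_zero hg0
  -- Setting `s = ϖ(t)` in the flow identity gives `ρ(h(t), t̄) = b(t, t̄) ρ(t, t̄)`.
  have step1 : ∀ j, subst g (ρ j) = ∑ k, subst ψ (B j k) * ρ k := by
    intro j
    have h1 := congrArg (subst ψ) (hB j)
    rw [subst_comp_subst_apply (hasSubst_of_constantCoeff_zero (by
      rintro (i | i) <;> simp [hφ0])) hψs] at h1
    simp only [← coe_substAlgHom hψs, map_sum, map_mul] at h1
    simp only [coe_substAlgHom] at h1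
    have h2 : (fun b => subst ψ (Sum.elim (fun i => rename Sum.inl (φ i))
        (fun i => X (Sum.inr i)) b : MvPowerSeries (Option (Fin n) ⊕ Fin n) ℂ)) = g := by
      funext b
      rcases b with i | i
      · simp only [Sum.elim_inl, g, hh, substTime]
        rw [subst_rename _ hψ0, rename_subst _ hel]
        rfl
      · simp only [Sum.elim_inr, g]
        rw [subst_X hψs]
        rfl
    rw [h2] at h1
    rw [h1]
    refine Finset.sum_congr rfl fun k _ => ?_
    rw [subst_rename _ hψ0]
    have h3 : (fun b => ψ (Sum.map some id b)) = X := by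
      funext b
      rcases b with i | i <;> simp [ψ, rename_X]
    rw [h3, subst_self, id]
  -- The mirror image of the previous identity under the involution, which fixes `ρ`: now `t̄` is
  -- moved and `t` is not.
  have step2 : ∀ j, subst (Sum.elim (fun i => X (Sum.inl i))
      (fun i => rename Sum.inr (conjSeries (h i))) : Fin n ⊕ Fin n → CRSeries n) (ρ j) =
      ∑ k, crConj (subst ψ (B j k)) * ρ k := by
    intro j
    have h1 := congrArg crConj (step1 j)
    rw [crConj_subst _ hg0, hreal] at h1
    have h2 : crConj (∑ k, subst ψ (B j k) * ρ k) = ∑ k, crConj (subst ψ (B j k)) * ρ k := by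
      conv_rhs => enter [2, k]; rw [← hreal k]
      simp only [crConj, conjSeries, map_sum, map_mul]
    rw [← h2, ← h1]
    congr 1
    funext b
    rcases b with i | i
    · simp [g, crConj, conjSeries, rename_X]
    · simp only [Sum.elim_inr, Sum.swap_inr, g, Sum.elim_inl, crConj, conjSeries]
      rw [← rename_map, rename_rename]
      rfl
  -- Replacing `t` by `h(t)` in the second identity produces `ρ(h(t), t̄)` on the right, to which
  -- the first identity applies; the matrices multiply.
  refine ⟨fun j l => ∑ k, subst g (crConj (subst ψ (B j k))) * subst ψ (B k l), fun j => ?_⟩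
  have h1 := congrArg (subst g) (step2 j)
  rw [subst_comp_subst_apply (hasSubst_of_constantCoeff_zero (by
    rintro (i | i) <;> simp [constantCoeff_rename, hh0'])) hgs] at h1
  simp only [← coe_substAlgHom hgs, map_sum, map_mul] at h1
  simp only [coe_substAlgHom, step1] at h1
  have h2 : (fun b => subst g (Sum.elim (fun i => X (Sum.inl i))
      (fun i => rename Sum.inr (conjSeries (h i))) b : CRSeries n)) =
      Sum.elim (fun i => rename Sum.inl (h i)) (fun i => rename Sum.inr (conjSeries (h i))) := by
    funext b
    rcases b with i | i
    · simp only [Sum.elim_inl]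
      rw [subst_X hgs]
      rfl
    · simp only [Sum.elim_inr]
      rw [subst_rename _ hg0, rename_eq_subst]
      rfl
  rw [h2] at h1
  rw [substCR, h1]
  simp only [Finset.mul_sum, Finset.sum_mul]
  rw [Finset.sum_comm]
  simp only [mul_assoc]

end flow

/-! ### Formal solutions of analytic equations -/

section taylor

variable {σ τ : Type*} [Fintype σ]

/-- Taylor's formula of order two with respect to one variable. -/
theorem exists_taylor_two [Finite τ] (P : MvPowerSeries (Option σ) ℂ) {ψ z : MvPowerSeries τ ℂ}
    {x : σ → MvPowerSeries τ ℂ} (hψ : constantCoeff ψ = 0) (hz : constantCoeff z = 0)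
    (hx : ∀ i, constantCoeff (x i) = 0) :
    ∃ Q, subst (fun o : Option σ => o.elim (ψ + z) x) P =
      subst (fun o : Option σ => o.elim ψ x) P +
        z * subst (fun o : Option σ => o.elim ψ x) (pderiv ℂ none P) + z ^ 2 * Q := by
  classical
  let ξ : Option σ → MvPowerSeries (Option σ ⊕ Unit) ℂ := fun o =>
    o.elim (X (Sum.inl none) + X (Sum.inr ())) fun i => X (Sum.inl (some i))
  have hξ : ∀ o, constantCoeff (ξ o) = 0 := by rintro (_ | i) <;> simp [ξ]
  have hξs := hasSubst_of_constantCoeff_zero hξ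
  have hlow : ∀ f : MvPowerSeries (Option σ) ℂ, ∀ α : Option σ ⊕ Unit →₀ ℕ,
      α (Sum.inr ()) = 0 → coeff α (subst ξ f) = coeff α (rename Sum.inl f) := by
    intro f α hα
    rw [rename_eq_subst]
    refine coeff_subst_congr (D := {α | α (Sum.inr ()) = 0}) (fun β γ hγ hβ => Nat.le_zero.mp
      ((hγ (Sum.inr ())).trans (le_of_eq hβ))) hξs (HasSubst.X_comp _) (fun o β hβ => ?_) f α hα
    rcases o with _ | i
    · have : β ≠ Finsupp.single (Sum.inr ()) 1 := by rintro rfl; simp at hβ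
      simp [ξ, coeff_X, this]
    · simp [ξ]
  -- Divisibility by the square of the increment: the remainder and its derivative in the increment
  -- both vanish where the increment is `0`.
  obtain ⟨Q, hQ⟩ : X (Sum.inr ()) ^ 2 ∣ subst ξ P - rename Sum.inl P -
      X (Sum.inr ()) * rename Sum.inl (pderiv ℂ none P) := by
    refine X_pow_dvd_iff.mpr fun α hα => ?_
    by_cases h0 : α (Sum.inr ()) = 0
    · rw [map_sub, map_sub, hlow P α h0, coeff_X_mul', if_pos h0, sub_self, sub_zero]
    have h1 : α (Sum.inr ()) = 1 := by omega
    set g := subst ξ P - rename Sum.inl P - X (Sum.inr ()) * rename Sum.inl (pderiv ℂ none P)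
      with hg
    have hd : pderiv ℂ (Sum.inr ()) g =
        subst ξ (pderiv ℂ none P) - rename Sum.inl (pderiv ℂ none P) := by
      rw [hg, map_sub, map_sub, pderiv_subst hξ, Fintype.sum_option, Derivation.leibniz,
        pderiv_rename_of_notMem _ (by simp), pderiv_rename_of_notMem _ (by simp)]
      have h2 : pderiv ℂ (Sum.inr ()) (ξ none) = 1 := by
        simp [ξ, pderiv_X_of_ne]
      have h3 : ∀ i, pderiv ℂ (Sum.inr ()) (ξ (some i)) = 0 := fun i => by
        simp [ξ, pderiv_X_of_ne]
      simp [h2, h3]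
    have h4 := congrArg (coeff (α - Finsupp.single (Sum.inr ()) 1)) hd
    have hle : Finsupp.single (Sum.inr ()) 1 ≤ α := by
      simpa [Finsupp.single_le_iff] using h1.ge
    have h5 : coeff (α - Finsupp.single (Sum.inr ()) 1)
        (subst ξ (pderiv ℂ none P) - rename Sum.inl (pderiv ℂ none P)) = 0 := by
      rw [map_sub, hlow _ _ (by simp [h1]), sub_self]
    rw [coeff_pderiv, tsub_add_cancel_of_le hle, h5] at h4
    exact (mul_eq_zero.mp h4).resolve_right (Nat.cast_add_one_ne_zero _)
  let k : Option σ ⊕ Unit → MvPowerSeries τ ℂ :=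
    Sum.elim (fun o => o.elim ψ x) fun _ => z
  have hk : ∀ b, constantCoeff (k b) = 0 := by rintro ((_ | i) | _) <;> simp [k, hψ, hz, hx]
  have hks := hasSubst_of_constantCoeff_zero hk
  refine ⟨subst k Q, ?_⟩
  have h5 := congrArg (subst k) hQ
  rw [subst_sub hks, subst_sub hks, subst_mul hks, subst_mul hks, subst_pow hks, subst_X hks,
    subst_rename _ hk, subst_rename _ hk, subst_comp_subst_apply hξs hks] at h5
  have h6 : (fun o => subst k (ξ o)) = fun o : Option σ => o.elim (ψ + z) x := by
    funext o
    rcases o with _ | i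
    · change subst k (X (Sum.inl none) + X (Sum.inr ())) = ψ + z
      rw [subst_add hks, subst_X hks, subst_X hks]
      rfl
    · change subst k (X (Sum.inl (some i))) = x i
      rw [subst_X hks]
      rfl
  rw [h6] at h5
  simp only [k, Sum.elim_inl, Sum.elim_inr] at h5
  rw [← h5]
  ring

/-- A formal solution of an analytic equation converges if it agrees to high order with a
convergent series, relative to the order of vanishing of the derivative along the solution. -/
theorem isConvergent_of_analytic_equation (l : σ) {P : MvPowerSeries (Option σ) ℂ}
    (hP : IsConvergent P) {p y v : MvPowerSeries σ ℂ} {k : ℕ} (hp : IsConvergent p)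
    (hp0 : constantCoeff p = 0) (hy0 : constantCoeff y = 0)
    (h : subst (fun o : Option σ => o.elim (p + X l ^ (k + 1) * y) X) P = 0)
    (hd : subst (fun o : Option σ => o.elim (p + X l ^ (k + 1) * y) X) (pderiv ℂ none P) =
      X l ^ k * v) (hv : constantCoeff v ≠ 0) : IsConvergent (p + X l ^ (k + 1) * y) := by
  classical
  set ψ := p + X l ^ (k + 1) * y with hψ
  have hψ0 : constantCoeff ψ = 0 := by simp [hψ, hp0]
  have hel : ∀ o : Option σ, constantCoeff (o.elim ψ X : MvPowerSeries σ ℂ) = 0 := by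
    rintro (_ | i) <;> simp [hψ0]
  let Y : MvPowerSeries (σ ⊕ Unit) ℂ := X (Sum.inr ())
  let x : σ → MvPowerSeries (σ ⊕ Unit) ℂ := fun i => X (Sum.inl i)
  let e : MvPowerSeries σ ℂ →ₐ[ℂ] MvPowerSeries (σ ⊕ Unit) ℂ := rename Sum.inl
  have he0 : ∀ f, constantCoeff (e f) = constantCoeff f := fun f => constantCoeff_rename _ _
  have heX : ∀ i, e (X i) = x i := fun i => rename_X _ _
  have hesub : ∀ f : MvPowerSeries (Option σ) ℂ,
      subst (fun o : Option σ => o.elim (e ψ) x) f =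
        e (subst (fun o : Option σ => o.elim ψ X) f) := by
    intro f
    simp only [e]
    rw [rename_subst _ hel]
    congr 1
    funext o
    rcases o with _ | i
    · rfl
    · exact (heX i).symm
  -- The unknown `y` is replaced by a free variable `Y`, and the equation is expanded about the
  -- known solution `ψ` with increment `x_l^(k+1) (Y - y)`.
  obtain ⟨Q, hQ⟩ := exists_taylor_two P (ψ := e ψ) (z := x l ^ (k + 1) * (Y - e y)) (x := x)
    (by rw [he0, hψ0]) (by simp [x]) (fun i => constantCoeff_X _)
  rw [hesub, hesub, h, hd, map_zero, zero_add, map_mul, map_pow, heX] at hQ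
  set T' := (Y - e y) * (e v + x l * (Y - e y) * Q) with hT'
  have harg : e ψ + x l ^ (k + 1) * (Y - e y) = e p + x l ^ (k + 1) * Y := by
    rw [hψ, map_add, map_mul, map_pow, heX]; ring
  have hTT : subst (fun o : Option σ => o.elim (e p + x l ^ (k + 1) * Y) x) P =
      x l ^ (2 * k + 1) * T' := by
    rw [← harg, hQ, hT']; ring
  -- The factors `y`, `v`, `Q` of `T'` are only formal, but `x_l^(2k+1) T'` is `P` at the convergent
  -- argument `p + x_l^(k+1) Y`.
  have hT'c : IsConvergent T' := by
    refine isConvergent_of_X_pow_mul (Sum.inl l) (2 * k + 1) ?_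
    change IsConvergent (x l ^ (2 * k + 1) * T')
    rw [← hTT]
    refine hP.subst ?_ ?_
    · rintro (_ | i)
      · exact (hp.rename _).add (((isConvergent_X _).pow _).mul (isConvergent_X _))
      · exact isConvergent_X _
    · rintro (_ | i)
      · simp [he0, hp0, x]
      · simp [x]
  set v0 := constantCoeff v with hv0
  have hYy0 : constantCoeff (Y - e y) = 0 := by simp [Y, he0, hy0]
  -- `T'` vanishes for `Y = y` and has linear coefficient `v(0) ≠ 0` in `Y`, so `Y = H` is an
  -- implicit equation in the required form. Its unique solution is both `y` and a convergent
  -- series.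
  let H : Unit → MvPowerSeries (σ ⊕ Unit) ℂ := fun _ => Y - C v0⁻¹ * T'
  have hH0 : ∀ j, constantCoeff (H j) = 0 := fun j => by simp [H, hT', hYy0, Y]
  have hYcoeff : coeff (Finsupp.single (Sum.inr ()) 1) (Y - e y) = 1 := by
    rw [map_sub, coeff_single_eq_constantCoeff_pderiv _ (e y),
      pderiv_rename_of_notMem _ (by simp)]
    simp [Y, coeff_X]
  have hH1 : ∀ j k, coeff (Finsupp.single (Sum.inr k) 1) (H j) = 0 := fun j k => by
    simp only [H, map_sub, coeff_C_mul]
    rw [hT', coeff_single_mul_of_zero _ hYy0, hYcoeff]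
    simp only [map_add, map_mul, hYy0, mul_zero, zero_mul, add_zero, he0, one_mul]
    rw [inv_mul_cancel₀ hv]
    simp [Y, coeff_X]
  have hHc : ∀ j, IsConvergent (H j) := fun j =>
    (isConvergent_X _).sub ((isConvergent_C _).mul hT'c)
  obtain ⟨Z, hZ0, hZ, hZc⟩ := exists_implicit H hH0 hH1 hHc
  have hy0' : ∀ j : Unit, constantCoeff ((fun _ => y : Unit → MvPowerSeries σ ℂ) j) = 0 :=
    fun _ => hy0
  have hys := hasSubst_of_constantCoeff_zero (constantCoeff_sumElim_X hy0')
  have hyZ : (fun _ => y) = Z := by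
    refine implicit_unique H hH1 hy0' hZ0 (fun j => ?_) hZ
    have h1 : subst (Sum.elim X fun _ => y : σ ⊕ Unit → MvPowerSeries σ ℂ) (Y - e y) = 0 := by
      rw [subst_sub hys]
      simp only [Y, e]
      rw [subst_X hys, subst_rename _ (constantCoeff_sumElim_X hy0')]
      simp only [Sum.elim_inl, Sum.elim_inr]
      rw [subst_self, id, sub_self]
    simp only [H]
    rw [subst_sub hys, subst_mul hys, hT', subst_mul hys, h1, zero_mul, mul_zero, sub_zero,
      subst_X hys]
    rfl
  have hyc : IsConvergent y := by
    have := hZc ()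
    rwa [← hyZ] at this
  exact hp.add (((isConvergent_X l).pow _).mul hyc)

end taylor

/-! ### Blowing up a point -/

section blowup

variable {σ : Type*}

/-- The map `(λ, u) ↦ λ (c + u)`. -/
def blowUp (c : σ → ℂ) (i : σ) : MvPowerSeries (Option σ) ℂ :=
  X none * (C (c i) + X (some i))

theorem constantCoeff_blowUp (c : σ → ℂ) (i : σ) : constantCoeff (blowUp c i) = 0 := by
  simp [blowUp]

theorem blowUp_finsuppProd [Finite σ] (c : σ → ℂ) (d : σ →₀ ℕ) :
    (d.prod fun i k => blowUp c i ^ k) = X none ^ d.degree *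
      rename some (d.prod fun i k => (C (c i) + X i : MvPowerSeries σ ℂ) ^ k) := by
  rw [map_finsuppProd]
  simp only [blowUp, mul_pow, Finsupp.prod, Finset.prod_mul_distrib, Finset.prod_pow_eq_pow_sum,
    map_pow, map_add, rename_C, rename_X]
  rfl

theorem X_pow_dvd_subst_blowUp [Finite σ] (c : σ → ℂ) {m : ℕ} {f : MvPowerSeries σ ℂ}
    (hf : ∀ α : σ →₀ ℕ, α.degree < m → coeff α f = 0) : X none ^ m ∣ subst (blowUp c) f := by
  classical
  refine X_pow_dvd_iff.mpr fun α hα => ?_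
  rw [coeff_subst (hasSubst_of_constantCoeff_zero (constantCoeff_blowUp c))]
  refine finsum_eq_zero_of_forall_eq_zero fun d => ?_
  by_cases hd : d.degree < m
  · rw [hf d hd, zero_smul]
  · rw [blowUp_finsuppProd, X_pow_eq, coeff_monomial_mul, if_neg, smul_zero]
    rw [Finsupp.single_le_iff]
    omega

/-- `f` has degree `|d|` with leading form the monomial `d`. -/
theorem leading_mul {f g : MvPowerSeries σ ℂ} {d d' : σ →₀ ℕ}
    (hf : ∀ β, d.degree ≤ β.degree → coeff β f = coeff β (monomial d 1))
    (hg : ∀ β, d'.degree ≤ β.degree → coeff β g = coeff β (monomial d' 1)) :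
    ∀ β, (d + d').degree ≤ β.degree → coeff β (f * g) = coeff β (monomial (d + d') 1) := by
  classical
  intro β hβ
  rw [← one_mul (1 : ℂ), ← monomial_mul_monomial, coeff_mul, coeff_mul]
  refine Finset.sum_congr rfl fun q hq => ?_
  rw [Finset.HasAntidiagonal.mem_antidiagonal] at hq
  have h1 : q.1.degree + q.2.degree = β.degree := by rw [← map_add, hq]
  rw [map_add] at hβ
  rcases lt_trichotomy q.1.degree d.degree with h | h | h
  · rw [hg q.2 (by omega), coeff_monomial_ne (m := q.2) (by rintro rfl; omega), mul_zero, mul_zero]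
  · rw [hf q.1 h.ge, hg q.2 (by omega)]
  · rw [hf q.1 h.le, coeff_monomial_ne (m := q.1) (by rintro rfl; omega), zero_mul, zero_mul]

theorem leading_prod (c : σ → ℂ) (d : σ →₀ ℕ) : ∀ β : σ →₀ ℕ, d.degree ≤ β.degree →
    coeff β (d.prod fun i k => (C (c i) + X i : MvPowerSeries σ ℂ) ^ k) =
      coeff β (monomial d 1) := by
  classical
  have hpow : ∀ (i : σ) (k : ℕ) (β : σ →₀ ℕ), (Finsupp.single i k).degree ≤ β.degree →
      coeff β ((C (c i) + X i : MvPowerSeries σ ℂ) ^ k) =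
        coeff β (monomial (Finsupp.single i k) 1) := by
    intro i k
    induction k with
    | zero => intro β _; rw [pow_zero, Finsupp.single_zero, monomial_zero_one]
    | succ k ih =>
      rw [pow_succ, Finsupp.single_add]
      refine leading_mul ih fun β hβ => ?_
      rw [Finsupp.degree_single] at hβ
      rw [map_add, coeff_C_of_ne_zero (by rintro rfl; simp at hβ), zero_add, X_def]
  induction d using Finsupp.induction with
  | zero => intro β _; rw [Finsupp.prod_zero_index, monomial_zero_one]
  | single_add i k d hi hk ih =>
    have h1 : ((Finsupp.single i k + d).prod fun i k => (C (c i) + X i : MvPowerSeries σ ℂ) ^ k) =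
        (C (c i) + X i) ^ k * d.prod fun i k => (C (c i) + X i : MvPowerSeries σ ℂ) ^ k := by
      rw [Finsupp.prod_add_index' (by simp) (by intros; rw [pow_add]),
        Finsupp.prod_single_index (by simp)]
    rw [h1]
    exact leading_mul (hpow i k) ih

/-- The term of exponent `d` pulls back to `λ^|d| ∏ (c_i + u_i)^(d_i)`. A contribution to `λ^|β|
u^β` requires `|d| = |β|`, and then only the top form `u^d` matters, so `d = β`. -/
theorem coeff_subst_blowUp [Finite σ] (c : σ → ℂ) (f : MvPowerSeries σ ℂ) (β : σ →₀ ℕ) :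
    coeff (Finsupp.single none β.degree + β.embDomain Function.Embedding.some)
      (subst (blowUp c) f) = coeff β f := by
  classical
  rw [coeff_subst (hasSubst_of_constantCoeff_zero (constantCoeff_blowUp c))]
  have hnone : (β.embDomain Function.Embedding.some) none = 0 :=
    Finsupp.embDomain_of_notMem_range _ _ _ (by simp)
  have key : ∀ d : σ →₀ ℕ,
      coeff (Finsupp.single none β.degree + β.embDomain Function.Embedding.some)
        (d.prod fun i k => blowUp c i ^ k) = if d = β then 1 else 0 := by
    intro d
    rw [blowUp_finsuppProd, X_pow_eq, coeff_monomial_mul, one_mul]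
    rcases lt_trichotomy d.degree β.degree with h | h | h
    · rw [if_neg (show d ≠ β by rintro rfl; omega)]
      split_ifs with h1
      · refine coeff_rename_eq_zero _ _ ?_
        rintro ⟨γ, hγ⟩
        have h2 := DFunLike.congr_fun hγ none
        rw [Finsupp.mapDomain_of_notMem_range _ _ (by simp)] at h2
        simp [hnone] at h2
        omega
      · rfl
    · rw [if_pos (by rw [h]; exact le_self_add), h, add_tsub_cancel_left]
      have h1 := coeff_embDomain_rename (Function.Embedding.some (α := σ))
        (d.prod fun i k => (C (c i) + X i : MvPowerSeries σ ℂ) ^ k) β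
      refine Eq.trans h1 ?_
      rw [leading_prod c d β h.le, coeff_monomial]
      simp only [eq_comm]
    · rw [if_neg, if_neg (show d ≠ β by rintro rfl; omega)]
      rw [Finsupp.single_le_iff]
      simp [hnone]
      omega
  rw [finsum_eq_single _ β fun d hd => by rw [key, if_neg hd, smul_zero], key, if_pos rfl,
    smul_eq_mul, mul_one]

theorem isConvergent_of_subst_blowUp [Finite σ] (c : σ → ℂ) {f : MvPowerSeries σ ℂ}
    (hf : IsConvergent (subst (blowUp c) f)) : IsConvergent f := by
  obtain ⟨K, hK, r, hr, h⟩ := hf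
  -- The coefficient of `β` reappears at an exponent of total degree `2 |β|`, hence the squared
  -- radius.
  refine ⟨K, hK, r ^ 2, by positivity, fun β => ?_⟩
  have h1 := h (Finsupp.single none β.degree + β.embDomain Function.Embedding.some)
  have h2 : (β.embDomain Function.Embedding.some).degree = β.degree := by
    simp [Finsupp.degree_apply]
  rw [coeff_subst_blowUp, map_add, Finsupp.degree_single, h2, ← two_mul, pow_mul, inv_pow] at h1
  exact h1

theorem isConvergent_coe (P : MvPolynomial σ ℂ) [Finite σ] :
    IsConvergent (P : MvPowerSeries σ ℂ) := by
  induction P using MvPolynomial.induction_on with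
  | C a => rw [MvPolynomial.coe_C]; exact isConvergent_C a
  | add p q hp hq => rw [MvPolynomial.coe_add]; exact hp.add hq
  | mul_X p i hp => rw [MvPolynomial.coe_mul, MvPolynomial.coe_X]; exact hp.mul (isConvergent_X i)

/-- The direction `c` is chosen where the leading form `P` does not vanish; then `f(λ(c + u)) = λ^m
(P(c + u) + λ q)`. -/
theorem exists_subst_blowUp_eq [Finite σ] {f : MvPowerSeries σ ℂ} (hf : f ≠ 0) :
    ∃ (c : σ → ℂ) (m : ℕ) (v : MvPowerSeries (Option σ) ℂ),
      subst (blowUp c) f = X none ^ m * v ∧ constantCoeff v ≠ 0 := by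
  obtain ⟨m, P, hPm, hP0, hP⟩ := exists_leading_form hf
  obtain ⟨c, hc⟩ : ∃ c, MvPolynomial.eval c P ≠ 0 := by
    by_contra! h
    exact hP0 (MvPolynomial.funext fun x => by rw [h, map_zero])
  have hs := hasSubst_of_constantCoeff_zero (constantCoeff_blowUp c)
  obtain ⟨q, hq⟩ := X_pow_dvd_subst_blowUp c (m := m + 1) (f := f - P) fun α hα => by
    rw [map_sub, hP α hα, sub_self]
  refine ⟨c, m, MvPolynomial.aeval (fun i => C (c i) + X (some i)) P + X none * q, ?_, ?_⟩
  · rw [subst_sub hs, subst_coe, sub_eq_iff_eq_add] at hq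
    rw [hq, mul_add, ← aeval_mul_of_isHomogeneous hPm, pow_succ]
    change _ + MvPolynomial.aeval (blowUp c) P = MvPolynomial.aeval (blowUp c) P + _
    ring
  · have h1 : constantCoeff (MvPolynomial.aeval
        (fun i => (C (c i) + X (some i) : MvPowerSeries (Option σ) ℂ)) P) =
        MvPolynomial.eval c P := by
      rw [MvPolynomial.aeval_def, MvPolynomial.hom_eval₂]
      simp only [map_add, constantCoeff_C, constantCoeff_X, add_zero]
      have : (constantCoeff (σ := Option σ) (R := ℂ)).comp
          (algebraMap ℂ (MvPowerSeries (Option σ) ℂ)) = RingHom.id ℂ := by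
        ext z
        simp [← c_eq_algebraMap]
      rw [this]
      rfl
    rw [map_add, h1]
    simpa using hc

end blowup

/-- If `g(ϖ(t), t)` converges and `∂_s g(ϖ(t), t)` does not vanish, then `ϖ` converges. -/
theorem isConvergent_of_isConvergent_substTime {n : ℕ} {g : MvPowerSeries (Option (Fin n)) ℂ}
    (hg : IsConvergent g) {ϖ : MvPowerSeries (Fin n) ℂ} (hϖ : constantCoeff ϖ = 0)
    (hc : IsConvergent (substTime ϖ g)) (hd : substTime ϖ (pderiv ℂ none g) ≠ 0) :
    IsConvergent ϖ := by
  classical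
  obtain ⟨c, m, v, hv, hv0⟩ := exists_subst_blowUp_eq hd
  have hel := constantCoeff_elim hϖ
  have hb0 := constantCoeff_blowUp c
  have hbs := hasSubst_of_constantCoeff_zero hb0
  have hbc : ∀ i, IsConvergent (blowUp c i) := fun i =>
    (isConvergent_X _).mul ((isConvergent_C _).add (isConvergent_X _))
  refine isConvergent_of_subst_blowUp c ?_
  set ψ := subst (blowUp c) ϖ with hψ
  have hψ0 : constantCoeff ψ = 0 := by rw [hψ, constantCoeff_subst_of_zero hb0, hϖ]
  -- Truncating below degree `m + 2` leaves a remainder divisible by `λ^(m+2)`: one power more than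
  -- the `λ^(m+1)` split off, so that the cofactor `λ q` has no constant term.
  let p := subst (blowUp c) (truncTotal (m + 2) ϖ : MvPowerSeries (Fin n) ℂ)
  have hpc : IsConvergent p := (isConvergent_coe _).subst hbc hb0
  have hp0 : constantCoeff p = 0 := by
    rw [constantCoeff_subst_of_zero hb0, ← coeff_zero_eq_constantCoeff_apply,
      MvPolynomial.coeff_coe, coeff_truncTotal _ (by simp), coeff_zero_eq_constantCoeff_apply, hϖ]
  obtain ⟨q, hq⟩ := X_pow_dvd_subst_blowUp c (m := m + 2)
    (f := ϖ - (truncTotal (m + 2) ϖ : MvPowerSeries (Fin n) ℂ)) fun α hα => by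
      rw [map_sub, MvPolynomial.coeff_coe, coeff_truncTotal _ hα, sub_self]
  have hψp : ψ = p + X none ^ (m + 1) * (X none * q) := by
    rw [subst_sub hbs, sub_eq_iff_eq_add] at hq
    rw [hψ, hq]
    change _ + p = _
    ring
  -- The substitution `(s, t) ↦ (s, λ(c + u))`; the outer `none` is the time `s`, the inner one is
  -- `λ`.
  let ζ : Option (Fin n) → MvPowerSeries (Option (Option (Fin n))) ℂ := fun o =>
    o.elim (X none) fun i => rename some (blowUp c i)
  have hζ0 : ∀ o, constantCoeff (ζ o) = 0 := by
    rintro (_ | i)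
    · simp [ζ]
    · simp only [ζ, Option.elim_some, constantCoeff_rename, hb0]
  have hζs := hasSubst_of_constantCoeff_zero hζ0
  have hψel : ∀ o : Option (Option (Fin n)),
      constantCoeff (o.elim ψ X : MvPowerSeries (Option (Fin n)) ℂ) = 0 := by
    rintro (_ | i) <;> simp [hψ0]
  have hψs := hasSubst_of_constantCoeff_zero hψel
  have hcomp : ∀ f : MvPowerSeries (Option (Fin n)) ℂ,
      subst (fun o : Option (Option (Fin n)) => o.elim ψ X) (subst ζ f) =
        subst (blowUp c) (substTime ϖ f) := by
    intro f
    rw [substTime, subst_comp_subst_apply hζs hψs,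
      subst_comp_subst_apply (hasSubst_of_constantCoeff_zero hel) hbs]
    congr 1
    funext o
    rcases o with _ | i
    · simp only [ζ, Option.elim_none]
      rw [subst_X hψs]
      rfl
    · simp only [ζ, Option.elim_some]
      rw [subst_rename _ hψel, subst_X hbs]
      simp only [Option.elim_some]
      rw [subst_self, id]
  rw [hψp]
  -- The equation is `g(s, λ(c + u))` minus the pullback of the convergent series `g(ϖ(t), t)`,
  -- which does not depend on `s`.
  refine isConvergent_of_analytic_equation (P := subst ζ g -
    rename some (subst (blowUp c) (substTime ϖ g))) (v := v) (k := m) none ?_ hpc hp0 (by simp)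
    ?_ ?_ hv0
  · refine (hg.subst ?_ hζ0).sub ((hc.subst hbc hb0).rename _)
    rintro (_ | i)
    · exact isConvergent_X _
    · exact (hbc i).rename _
  · rw [← hψp, subst_sub hψs, hcomp, subst_rename _ hψel]
    simp only [Option.elim_some]
    rw [subst_self, id, sub_self]
  · rw [← hψp, map_sub, pderiv_rename_of_notMem _ (by simp), sub_zero, pderiv_subst hζ0,
      Fintype.sum_option]
    have h1 : pderiv ℂ none (ζ none) = 1 := pderiv_X_self
    have h2 : ∀ i, pderiv ℂ none (ζ (some i)) = 0 := fun i =>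
      pderiv_rename_of_notMem _ (by simp) _
    simp only [h1, h2, mul_one, mul_zero, Finset.sum_const_zero, add_zero]
    rw [hcomp, hv]

/-! ### Nonconvergent formal CR equivalences -/

section nonconvergent

variable {n d : ℕ}

/-- The divergent power series `∑_{m ≥ N} m! t_i^m`. -/
def factorialSeries (i : Fin n) (N : ℕ) : MvPowerSeries (Fin n) ℂ :=
  fun β => if β = Finsupp.single i (β i) ∧ N ≤ β i then ((β i).factorial : ℂ) else 0

theorem coeff_factorialSeries (i : Fin n) (N : ℕ) (β : Fin n →₀ ℕ) :
    coeff β (factorialSeries i N) =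
      if β = Finsupp.single i (β i) ∧ N ≤ β i then ((β i).factorial : ℂ) else 0 := rfl

theorem coeff_factorialSeries_of_degree_lt (i : Fin n) {N : ℕ} {β : Fin n →₀ ℕ}
    (hβ : β.degree < N) : coeff β (factorialSeries i N) = 0 := by
  rw [coeff_factorialSeries, if_neg]
  rintro ⟨-, h⟩
  have := Finsupp.le_degree i β
  omega

theorem not_isConvergent_factorialSeries (i : Fin n) (N : ℕ) :
    ¬ IsConvergent (factorialSeries i N) := by
  rintro ⟨K, hK, r, hr, h⟩
  have hlim := (FloorSemiring.tendsto_pow_div_factorial_atTop r⁻¹).const_mul K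
  rw [mul_zero] at hlim
  obtain ⟨m, hm, hmN⟩ := ((hlim.eventually_lt_const one_pos).and (eventually_ge_atTop N)).exists
  have h1 := h (Finsupp.single i m)
  rw [coeff_factorialSeries, if_pos (by simp [hmN]), Finsupp.degree_single, Finsupp.single_eq_same,
    Complex.norm_natCast] at h1
  have h2 : (0 : ℝ) < m.factorial := by exact_mod_cast m.factorial_pos
  rw [← mul_div_assoc, div_lt_one h2] at hm
  exact absurd h1 (not_le.mpr hm)

theorem coeff_substTime_of_degree_lt {N : ℕ} {ϖ : MvPowerSeries (Fin n) ℂ}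
    (h0 : constantCoeff ϖ = 0) (hϖ : ∀ β : Fin n →₀ ℕ, β.degree < N → coeff β ϖ = 0)
    (g : MvPowerSeries (Option (Fin n)) ℂ) {β : Fin n →₀ ℕ} (hβ : β.degree < N) :
    coeff β (substTime ϖ g) = coeff β (substTime 0 g) := by
  refine coeff_subst_congr (D := {β | β.degree < N})
    (fun β γ hγ hβ => (Finsupp.degree_mono hγ).trans_lt hβ)
    (hasSubst_of_constantCoeff_zero (constantCoeff_elim h0))
    (hasSubst_of_constantCoeff_zero (constantCoeff_elim (map_zero _))) (fun o γ hγ => ?_) g β hβ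
  rcases o with _ | k
  · rw [Option.elim_none, Option.elim_none, hϖ γ hγ, map_zero]
  · rfl

/-- This is the flow equation at time `0`; it lets the nonvanishing of `a i` be transferred to `∂_s
φ_i(ϖ, t)`. -/
theorem substTime_zero_pderiv {a : Fin n → MvPowerSeries (Fin n) ℂ}
    {φ : Fin n → MvPowerSeries (Option (Fin n)) ℂ} (hφ : IsLocalFlow a φ) (i : Fin n) :
    substTime 0 (pderiv ℂ none (φ i)) = a i := by
  have h : (fun k => substTime 0 (φ k)) = X := funext hφ.initial
  rw [hφ.ode, substTime, subst_comp_subst_apply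
    (hasSubst_of_constantCoeff_zero hφ.constantCoeff_eq_zero)
    (hasSubst_of_constantCoeff_zero (constantCoeff_elim (map_zero _)))]
  change subst (fun k => substTime 0 (φ k)) (a i) = a i
  rw [h, subst_self, id]

theorem jacobian_substTime {a : Fin n → MvPowerSeries (Fin n) ℂ}
    {φ : Fin n → MvPowerSeries (Option (Fin n)) ℂ} (hφ : IsLocalFlow a φ) {N : ℕ} (hN : 2 ≤ N)
    {ϖ : MvPowerSeries (Fin n) ℂ} (h0 : constantCoeff ϖ = 0)
    (hϖ : ∀ β : Fin n →₀ ℕ, β.degree < N → coeff β ϖ = 0) :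
    (Matrix.of fun i k => constantCoeff (pderiv ℂ k (substTime ϖ (φ i)))) =
      (1 : Matrix (Fin n) (Fin n) ℂ) := by
  classical
  ext i k
  have h : substTime 0 (φ i) = X i := hφ.initial i
  rw [Matrix.of_apply, ← coeff_single_eq_constantCoeff_pderiv,
    coeff_substTime_of_degree_lt h0 hϖ _ (by rw [Finsupp.degree_single]; omega), h, coeff_X,
    Matrix.one_apply]
  simp only [Finsupp.single_left_inj one_ne_zero, eq_comm]

end nonconvergent

end

end FormalCR

/-! ### The main theorem -/

theorem mainTheorem8 (n d : ℕ) (hd : 1 ≤ d) (hn : d < n)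
    (ρ : Fin d → CRSeries n) (hρ : IsGenericDefining ρ) :
    (∀ a : Fin n → MvPowerSeries (Fin n) ℂ,
      (∀ i, IsConvergent (a i)) → a ≠ 0 → IsTangent a ρ →
      (∃ φ : Fin n → MvPowerSeries (Option (Fin n)) ℂ, IsLocalFlow a φ) ∧
      ∀ φ : Fin n → MvPowerSeries (Option (Fin n)) ℂ, IsLocalFlow a φ →
        ∀ (i : Fin n) (ϖ : MvPowerSeries (Fin n) ℂ),
          MvPowerSeries.constantCoeff ϖ = 0 →
          ¬ IsConvergent ϖ →
          substTime ϖ (MvPowerSeries.pderiv ℂ none (φ i)) ≠ 0 →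
          IsFormalCRMap ρ ρ (fun k => substTime ϖ (φ k)) ∧
            ¬ IsConvergentMap (fun k => substTime ϖ (φ k))) ∧
    ((∀ h : Fin n → MvPowerSeries (Fin n) ℂ, IsFormalCREquiv ρ ρ h → IsConvergentMap h) →
      IsHolNondegenerate ρ) := by
  have main : ∀ a : Fin n → MvPowerSeries (Fin n) ℂ, (∀ i, IsConvergent (a i)) →
      IsTangent a ρ → ∀ φ : Fin n → MvPowerSeries (Option (Fin n)) ℂ, IsLocalFlow a φ →
      ∀ (i : Fin n) (ϖ : MvPowerSeries (Fin n) ℂ), MvPowerSeries.constantCoeff ϖ = 0 →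
      ¬ IsConvergent ϖ → substTime ϖ (MvPowerSeries.pderiv ℂ none (φ i)) ≠ 0 →
      IsFormalCRMap ρ ρ (fun k => substTime ϖ (φ k)) ∧
        ¬ IsConvergentMap (fun k => substTime ϖ (φ k)) :=
    fun a ha hT φ hφ i ϖ hϖ0 hϖ hne => ⟨isFormalCRMap_substTime hρ ha hT hφ hϖ0, fun hc =>
      hϖ (isConvergent_of_isConvergent_substTime (hφ.convergent i) hϖ0 (hc i) hne)⟩
  refine ⟨fun a ha _ hT => ⟨exists_isLocalFlow a ha, main a ha hT⟩, ?_⟩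
  rintro hall ⟨a, ha, hne, hT⟩
  obtain ⟨φ, hφ⟩ := exists_isLocalFlow a ha
  obtain ⟨i, hi⟩ := Function.ne_iff.mp hne
  obtain ⟨α, hα⟩ := (MvPowerSeries.ne_zero_iff_exists_coeff_ne_zero (a i)).mp hi
  let i₀ : Fin n := ⟨0, by omega⟩
  -- The order `|α| + 2` exceeds `|α|`, so `∂_s φ_i(ϖ, t)` keeps the nonzero coefficient of `a i` at
  -- `α`; it is also at least `2`, so the Jacobian at the origin is the identity.
  set ϖ := factorialSeries i₀ (α.degree + 2) with hϖdef
  have hϖ : ∀ β : Fin n →₀ ℕ, β.degree < α.degree + 2 → MvPowerSeries.coeff β ϖ = 0 :=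
    fun β hβ => coeff_factorialSeries_of_degree_lt i₀ hβ
  have hϖ0 : MvPowerSeries.constantCoeff ϖ = 0 := by
    rw [← MvPowerSeries.coeff_zero_eq_constantCoeff_apply]
    exact hϖ 0 (by simp)
  have hd0 : substTime ϖ (MvPowerSeries.pderiv ℂ none (φ i)) ≠ 0 := by
    intro h
    have h1 := coeff_substTime_of_degree_lt hϖ0 hϖ (MvPowerSeries.pderiv ℂ none (φ i))
      (β := α) (by omega)
    rw [h, substTime_zero_pderiv hφ, map_zero] at h1
    exact hα h1.symm
  obtain ⟨h1, h2⟩ := main a ha hT φ hφ i ϖ hϖ0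
    (not_isConvergent_factorialSeries i₀ _) hd0
  refine h2 (hall _ ⟨h1, ?_⟩)
  rw [jacobian_substTime hφ (N := α.degree + 2) (by omega) hϖ0 hϖ, Matrix.det_one]
  exact one_ne_zero
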